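/- **Theorem.** Let $k\ge 1$ and $n$ be integers and let $\vec G$ be a directed graph without self-loops whose nodes are a source $0$ and $n$ receivers. Assume that $\vec G$ is $(k,n)$-TSS feasible: the source has an edge to every receiver, and every receiver has in-degree (the edge from the source included) greater than $k$. For a receiver $j$ let $\mathcal N_j^+$ be the set of receivers $i$ with an edge $e_{ij}$ to $j$, and $n_j=|\mathcal N_j^+|$. The source generates updates at the points $\tau_1<\tau_2<\cdots$ of a Poisson process $N_0$ of rate $\lambda_s>0$, $N_0(t)$ being the current version at time $t$ and $\tau_0=0$. Each edge $e_{ij}$ between receivers is activated at the points of a Poisson process $N^{ij}$ of rate $\lambda_{ij}>0$, and all these processes are mutually independent. At time $\tau_\ell$ the source splits version $\ell$ into $n$ distinct keys, any $k+1$ of which suffice for decryption, and sends one to each receiver (full subscription). In the memoryless scheme, when $e_{ij}$ is activated at time $t$, node $i$ sends to $j$ only the key of the current version $N_0(t)$ that it got itself from the source. Let $N_j^k(t)$ be the latest version of which at least $k+1$ distinct keys have reached $j$ by time $t$ ($0$ if there is none), and let $\bar A_j(k,t)=N_0(t)-N_j^k(t)$ be the $k$-keys version age of $j$. Let $U$ be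 a time between two successive source updates; for $i\in\mathcal N_j^+$ let $X_{ij}$ be a time between two successive activations of $e_{ij}$ (time $0$ is taken as the zeroth point of each process), and let $\mathcal X_{(k:n_j)}$ be the $k$-th smallest of the $n_j$ variables $X_{ij}$. Then, for every receiver $j$, with probability $1$ the time average of the age exists and $$\bar\Delta_j(k):=\lim_{t\to\infty}\frac1t\int_0^t\bar A_j(k,s)\,ds=\frac{\mathbb E[\min(\mathcal X_{(k:n_j)},U)]}{\Pr(\mathcal X_{(k:n_j)}\le U)\,\mathbb E[U]},$$ where both expectations are finite and the denominator is positive. -/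

import Mathlib

open MeasureTheory ProbabilityTheory Filter Topology
open scoped NNReal ENNReal

noncomputable section

namespace CodedGossip

/-! ### Poisson counters -/

/-- `N` is a Poisson counter of rate `r` under `P`: it starts at `0`, its paths are
nondecreasing and right-continuous, its increments over consecutive time intervals are
independent, and the increment over `(s, t]` has the Poisson law of mean `r * (t - s)`. -/
structure IsPoissonCounter {Ω : Type*} [MeasurableSpace Ω] (P : Measure Ω)
    (N : ℝ≥0 → Ω → ℕ) (r : ℝ≥0) : Prop where
  measurable : ∀ t, Measurable (N t)
  zero : ∀ᵐ ω ∂P, N 0 ω = 0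
  monotone : ∀ᵐ ω ∂P, Monotone (fun t => N t ω)
  rightContinuous : ∀ᵐ ω ∂P, ∀ t, ContinuousWithinAt (fun s => N s ω) (Set.Ici t) t
  indepIncrements : HasIndepIncrements N P
  law : ∀ s t, s ≤ t → HasLaw (fun ω => N t ω - N s ω) (poissonMeasure (r * (t - s))) P

/-- The time of the `a`-th point of the counter `N`; the `0`-th one is time `0`. -/
def arrivalTime {Ω : Type*} (N : ℝ≥0 → Ω → ℕ) (a : ℕ) (ω : Ω) : ℝ≥0 :=
  sInf {t | a ≤ N t ω}

/-- The time between the `a`-th and the `(a+1)`-th point of the counter `N`. -/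
def interarrivalTime {Ω : Type*} (N : ℝ≥0 → Ω → ℕ) (a : ℕ) (ω : Ω) : ℝ :=
  (arrivalTime N (a + 1) ω : ℝ) - arrivalTime N a ω

/-! ### Order statistics -/

/-- The `k`-th smallest member of a finite real family `x`, where `1 ≤ k` and `k` is at most the
number of members: the least `t` such that at least `k` of the members are `≤ t`. -/
def orderStat {ι : Type*} (k : ℕ) (x : ι → ℝ) : ℝ :=
  sInf {t | k ≤ {i | x i ≤ t}.ncard}

/-! ### The network

The source is `none` and the receivers are `some j` with `j : Fin n`. In full subscription each of
the `n` keys of an update is sent to exactly one of the `n` receivers, so the key that receiver `i`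
gets from the source for version `ℓ` is identified by the pair `(i, ℓ)`. -/

/-- Feasibility: the source has an edge to each receiver, and the in-degree of
each receiver, with the edge from the source counted, is greater than `k`. -/
def IsTSSFeasible {n : ℕ} (G : Digraph (Option (Fin n))) (k : ℕ) : Prop :=
  (∀ j : Fin n, G.Adj none (some j)) ∧
    ∀ j : Fin n, k < {v : Option (Fin n) | G.Adj v (some j)}.ncard

/-- The edges `(i, j)` between receivers, along which gossip takes place. -/
abbrev GossipEdge {n : ℕ} (G : Digraph (Option (Fin n))) : Type :=
  {e : Fin n × Fin n // G.Adj (some e.1) (some e.2)}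

/-- The receivers with an edge to receiver `j`. -/
abbrev InNeighbor {n : ℕ} (G : Digraph (Option (Fin n))) (j : Fin n) : Type :=
  {i : Fin n // G.Adj (some i) (some j)}

/-- The edge from the in-neighbor `i` of `j` to `j`. -/
def InNeighbor.edge {n : ℕ} {G : Digraph (Option (Fin n))} {j : Fin n} (i : InNeighbor G j) :
    GossipEdge G :=
  ⟨(i.1, j), i.2⟩

section Scheme

variable {Ω : Type*} {n : ℕ} {G : Digraph (Option (Fin n))}

/-- All counters of the network: `N₀` counts the source updates, `N e` the activations of `e`. -/
def counters (N₀ : ℝ≥0 → Ω → ℕ) (N : GossipEdge G → ℝ≥0 → Ω → ℕ) :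
    Option (GossipEdge G) → Ω → (ℝ≥0 → ℕ)
  | none => fun ω t => N₀ t ω
  | some e => fun ω t => N e t ω

/-- The keys of version `ℓ` (named by the receiver to which the source sent them) that have reached
receiver `j` by time `t` in the memoryless scheme with full subscription: its own key, sent when
version `ℓ` is generated, and the key of each in-neighbor `i` such that the edge from `i` to `j`
has been activated by time `t` at a moment when `ℓ` was the current version of the source. -/
def keysReceived (N₀ : ℝ≥0 → Ω → ℕ) (N : GossipEdge G → ℝ≥0 → Ω → ℕ)
    (j : Fin n) (ℓ : ℕ) (t : ℝ≥0) (ω : Ω) : Set (Fin n) :=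
  {i | (i = j ∧ arrivalTime N₀ ℓ ω ≤ t) ∨
    ∃ h : G.Adj (some i) (some j), ∃ a : ℕ, 1 ≤ a ∧
      arrivalTime (N ⟨(i, j), h⟩) a ω ≤ t ∧
      N₀ (arrivalTime (N ⟨(i, j), h⟩) a ω) ω = ℓ}

/-- The latest version that receiver `j` can decrypt at time `t`, that is, of which at least
`k + 1` keys have reached it. Before any version is decrypted the value is `0`. -/
def latestDecrypted (k : ℕ) (N₀ : ℝ≥0 → Ω → ℕ) (N : GossipEdge G → ℝ≥0 → Ω → ℕ)
    (j : Fin n) (t : ℝ≥0) (ω : Ω) : ℕ :=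
  sSup {ℓ | k + 1 ≤ (keysReceived N₀ N j ℓ t ω).ncard}

/-- The `k`-keys version age of receiver `j` at time `t` in the memoryless scheme. -/
def versionAge (k : ℕ) (N₀ : ℝ≥0 → Ω → ℕ) (N : GossipEdge G → ℝ≥0 → Ω → ℕ)
    (j : Fin n) (t : ℝ≥0) (ω : Ω) : ℝ :=
  (N₀ t ω : ℝ) - (latestDecrypted k N₀ N j t ω : ℝ)

/-- The `k`-th order statistic of the inter-activation times of the edges into receiver `j`, where
for each edge `e` the time between its `a e`-th and `(a e + 1)`-th activation is taken. -/
def edgeOrderStat (k : ℕ) (N : GossipEdge G → ℝ≥0 → Ω → ℕ) (a : GossipEdge G → ℕ)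
    (j : Fin n) (ω : Ω) : ℝ :=
  orderStat k (fun i : InNeighbor G j => interarrivalTime (N i.edge) (a i.edge) ω)

end Scheme

end CodedGossip

end

/-! Cut time into cycles at the source updates τ_ℓ. Without memory, a key of version ℓ can reach j
from a neighbor only during cycle ℓ, and j already holds its own key. So version ℓ is decrypted
exactly when k incoming edges fire within the cycle, that is, when the k-th smallest waiting time is
below the cycle length. The age during cycle ℓ equals a number B_ℓ until that moment and 0
afterwards, where B_ℓ counts the cycles since the last success (`versionAge_eq`). The integral of
the age over the cycle is therefore B_ℓ M_ℓ, with M_ℓ the minimum of the k-th waiting time and the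
cycle length (`intervalIntegral_versionAge_cycle`).

By the strong Markov property (`measure_inter_lt_gap`, `indep_gaps`) the vector W_ℓ of waiting times
after τ_ℓ is independent of the past of τ_ℓ and consists of independent exponentials. B_ℓ belongs to
that past. M_ℓ and the success indicator Y_ℓ depend only on W_ℓ truncated at the end of the cycle,
so they are known at τ_{ℓ+1}.

Put p = E Y and m = E M. The variables B_ℓ (m Y_ℓ − p M_ℓ) are orthogonal and bounded in L², because
B_ℓ has uniformly bounded second moments; their averages tend to 0 almost surely
(`ae_tendsto_average_of_orthogonal`). Since ∑_{ℓ<L} B_ℓ Y_ℓ telescopes to L − B_L and B_L / L → 0,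
the averages of B_ℓ M_ℓ tend to m / p (`ae_tendsto_average_staleness`). Likewise τ_L / L → E U, and
a sandwich between updates (`tendsto_time_average`) gives the limit m / (p E U). -/

namespace CodedGossip

/-! ### Markov property at a fixed time -/

section Past

variable {Ω : Type*} [MeasurableSpace Ω] {P : Measure Ω}

/-- The values of a process with independent increments up to time `t` are independent of the
increment after `t`. -/
lemma indepFun_past_increment [IsProbabilityMeasure P] {N : ℝ≥0 → Ω → ℕ}
    (hm : ∀ t, Measurable (N t)) (h0 : ∀ ω, N 0 ω = 0) (hmono : ∀ ω, Monotone fun t => N t ω)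
    (hI : HasIndepIncrements N P) {t u : ℝ≥0} (htu : t ≤ u) :
    IndepFun (fun ω (s : Set.Iic t) => N s ω) (fun ω => N u ω - N t ω) P := by
  classical
  refine IndepFun.process_indepFun (fun s => hm s) ((hm u).sub (hm t)) fun I => ?_
  -- It suffices to treat finitely many past times. Together with 0 and t they are listed
  -- increasingly as σ 0 = 0, …, σ m = t, followed by u. As the counter starts at 0, each past value
  -- is a sum of increments with index below m, while the future increment has index m.
  set S : Finset ℝ≥0 := insert 0 (insert t (I.image Subtype.val)) with hS
  have hSt : ∀ s ∈ S, s ≤ t := by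
    intro s hs
    simp only [hS, Finset.mem_insert, Finset.mem_image] at hs
    rcases hs with rfl | rfl | ⟨x, -, rfl⟩
    · exact zero_le
    · exact le_rfl
    · exact x.2
  have h0S : (0 : ℝ≥0) ∈ S := by simp [hS]
  have htS : t ∈ S := by simp [hS]
  obtain ⟨m, hcard⟩ : ∃ m, S.card = m + 1 :=
    ⟨S.card - 1, by have := Finset.card_pos.mpr ⟨_, h0S⟩; omega⟩
  let e := S.orderEmbOfFin hcard
  let σ : ℕ → ℝ≥0 := fun i => if h : i < m + 1 then e ⟨i, h⟩ else u
  have heS : ∀ i, e i ∈ S := fun i => S.orderEmbOfFin_mem hcard i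
  have hidx : ∀ s ∈ S, ∃ i, i ≤ m ∧ σ i = s := by
    intro s hs
    have : s ∈ Set.range e := by rw [Finset.range_orderEmbOfFin]; exact hs
    obtain ⟨i, rfl⟩ := this
    exact ⟨i, by omega, by simp only [σ, i.2, dif_pos]⟩
  have hσmono : Monotone σ := by
    intro i i' hii
    by_cases h1 : i' < m + 1
    · have h2 : i < m + 1 := by omega
      simp only [σ, h1, h2, dif_pos]
      exact e.monotone hii
    · by_cases h2 : i < m + 1
      · simp only [σ, h1, h2, dif_pos, dif_neg, not_false_iff]
        exact (hSt _ (heS _)).trans htu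
      · simp only [σ, h1, h2, dif_neg, not_false_iff, le_refl]
  have hσ0 : σ 0 = 0 := by
    obtain ⟨i, -, hi⟩ := hidx 0 h0S
    exact le_antisymm (hi ▸ hσmono (Nat.zero_le i)) zero_le
  have hσm : σ m = t := by
    obtain ⟨i, him, hi⟩ := hidx t htS
    refine le_antisymm ?_ (hi ▸ hσmono him)
    simp only [σ, Nat.lt_succ_self, dif_pos]
    exact hSt _ (heS _)
  have hσm1 : σ (m + 1) = u := by simp [σ]
  have hInd := (hI.nat hσmono).indepFun_finset (Finset.range m) {m} (by simp)
    (fun i => (hm _).sub (hm _))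
  have hi : ∀ s : I, ∃ i, i ≤ m ∧ σ i = s.1.1 := fun s =>
    hidx _ (by simp only [hS, Finset.mem_insert, Finset.mem_image]
               exact Or.inr (Or.inr ⟨s.1, s.2, rfl⟩))
  choose idx hidm hidσ using hi
  have := hInd.comp
    (φ := fun (x : Finset.range m → ℕ) (s : I) => ∑ l, if l.1 < idx s then x l else 0)
    (ψ := fun (y : ({m} : Finset ℕ) → ℕ) => y ⟨m, by simp⟩)
    (by
      refine measurable_pi_lambda _ fun s => Finset.measurable_sum _ fun l _ => ?_
      split_ifs
      · exact measurable_pi_apply l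
      · exact measurable_const)
    (measurable_pi_apply (X := fun _ : ({m} : Finset ℕ) => ℕ) ⟨m, by simp⟩)
  convert this using 1
  · funext ω s
    simp only [Function.comp]
    rw [Finset.sum_coe_sort (Finset.range m)
      (fun l => if l < idx s then N (σ (l + 1)) ω - N (σ l) ω else 0), ← Finset.sum_filter]
    have : (Finset.range m).filter (fun l => l < idx s) = Finset.range (idx s) := by
      ext l; simp only [Finset.mem_filter, Finset.mem_range]; have := hidm s; omega
    rw [this, Finset.sum_range_tsub (f := fun l => N (σ l) ω) ((hmono ω).comp hσmono), hσ0, h0,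
      hidσ]
    simp
  · funext ω
    simp [hσm, hσm1]

end Past

/-- A finite family of independent Poisson counters, all of whose paths are well behaved. -/
structure IsPoissonFamily {Ω C : Type*} [MeasurableSpace Ω] (P : Measure Ω)
    (N : C → ℝ≥0 → Ω → ℕ) (r : C → ℝ≥0) : Prop where
  measurable : ∀ c t, Measurable (N c t)
  zero : ∀ c ω, N c 0 ω = 0
  monotone : ∀ c ω, Monotone (fun t => N c t ω)
  rightContinuous : ∀ c ω t, ∀ᶠ s in 𝓝[≥] t, N c s ω = N c t ω
  unbounded : ∀ c ω a, ∃ t, a ≤ N c t ω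
  indepIncrements : ∀ c, HasIndepIncrements (N c) P
  law : ∀ c s t, s ≤ t → HasLaw (fun ω => N c t ω - N c s ω) (poissonMeasure (r c * (t - s))) P
  indep : iIndepFun (fun c ω t => N c t ω) P
  rate_pos : ∀ c, 0 < r c

lemma comap_pi_le {Ω ι : Type*} {m : MeasurableSpace Ω} {f : ι → Ω → ℕ} (h : ∀ i, Measurable (f i)) :
    MeasurableSpace.comap (fun ω i => f i ω) inferInstance ≤ m :=
  (measurable_pi_lambda _ h).comap_le

/-- The events of the counter `N` up to time `t`. -/
@[reducible]
def pastOf {Ω : Type*} (N : ℝ≥0 → Ω → ℕ) (t : ℝ≥0) : MeasurableSpace Ω :=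
  MeasurableSpace.comap (fun ω (s : Set.Iic t) => N s ω) inferInstance

/-- The events of the family `N` of counters up to time `t`. -/
@[reducible]
def past {Ω C : Type*} (N : C → ℝ≥0 → Ω → ℕ) (t : ℝ≥0) : MeasurableSpace Ω :=
  ⨆ c, pastOf (N c) t

lemma measurable_past {Ω C : Type*} (N : C → ℝ≥0 → Ω → ℕ) (c : C) {s t : ℝ≥0} (h : s ≤ t) :
    Measurable[past N t] (N c s) := by
  have h1 : Measurable[pastOf (N c) t] (N c s) := by
    have : N c s = (fun x : Set.Iic t → ℕ => x ⟨s, h⟩) ∘ (fun ω (s : Set.Iic t) => N c s ω) := rfl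
    rw [this]
    exact (measurable_pi_apply _).comp (comap_measurable _)
  exact h1.mono (le_iSup (fun c => pastOf (N c) t) c) le_rfl

lemma past_mono {Ω C : Type*} (N : C → ℝ≥0 → Ω → ℕ) {s t : ℝ≥0} (h : s ≤ t) :
    past N s ≤ past N t := by
  refine iSup_le fun c => ?_
  exact comap_pi_le fun x => measurable_past N c (x.2.trans h)

section Family

variable {Ω C : Type*} {mΩ : MeasurableSpace Ω} {P : Measure Ω} {N : C → ℝ≥0 → Ω → ℕ} {r : C → ℝ≥0}

namespace IsPoissonFamily

lemma past_le (h : IsPoissonFamily P N r) (t : ℝ≥0) : past N t ≤ mΩ := by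
  refine iSup_le fun c => ?_
  exact comap_pi_le fun x => h.measurable c x

lemma measure_noJump (h : IsPoissonFamily P N r) (c : C) (t u : ℝ≥0) :
    P {ω | N c (t + u) ω = N c t ω} = ENNReal.ofReal (Real.exp (-(r c * u))) := by
  have h1 := (h.law c t (t + u) le_self_add).map_eq
  have h2 : P.map (fun ω => N c (t + u) ω - N c t ω) {0} =
      ENNReal.ofReal (Real.exp (-(r c * u))) := by
    rw [h1, poissonMeasure_singleton]
    simp
  have hm : Measurable fun ω => N c (t + u) ω - N c t ω :=
    (h.measurable c _).sub (h.measurable c _)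
  rw [Measure.map_apply hm (measurableSet_singleton 0)] at h2
  rw [← h2]
  congr 1
  ext ω
  have := h.monotone c ω (le_self_add : t ≤ t + u)
  simp only [Set.mem_ofPred_eq, Set.mem_preimage, Set.mem_singleton_iff] at *
  omega

/-- Markov property: the absence of jumps after time `t` is independent of the past of `t`. -/
lemma measure_inter_noJump [Fintype C] [IsProbabilityMeasure P] (h : IsPoissonFamily P N r)
    {t : ℝ≥0} (u : C → ℝ≥0) {F : Set Ω} (hF : MeasurableSet[past N t] F) :
    P (F ∩ {ω | ∀ c, N c (t + u c) ω = N c t ω}) =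
      P F * ∏ c, ENNReal.ofReal (Real.exp (-(r c * u c))) := by
  classical
  set E : C → Set Ω := fun c => {ω | N c (t + u c) ω = N c t ω} with hE
  have hEset : {ω | ∀ c, N c (t + u c) ω = N c t ω} = ⋂ c, E c := by ext; simp [hE]
  have hpath : ∀ c s, Measurable[MeasurableSpace.comap (fun ω t => N c t ω) inferInstance]
      (N c s) := fun c s => by
    have : N c s = (fun x : ℝ≥0 → ℕ => x s) ∘ (fun ω t => N c t ω) := rfl
    rw [this]
    exact (measurable_pi_apply _).comp (comap_measurable _)
  have hpast : ∀ c, pastOf (N c) t ≤ MeasurableSpace.comap (fun ω t => N c t ω) inferInstance := by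
    exact fun c => comap_pi_le fun s => hpath c s
  have hEm : ∀ c, MeasurableSet[MeasurableSpace.comap (fun ω t => N c t ω) inferInstance] (E c) :=
    fun c => ⟨{x | x (t + u c) = x t},
      measurableSet_eq_fun (measurable_pi_apply _) (measurable_pi_apply _), rfl⟩
  have hind := (iIndepFun_iff_iIndep _ _ _).1 h.indep
  have hpathle : ∀ c, MeasurableSpace.comap (fun ω t => N c t ω) inferInstance ≤
      mΩ := by
    exact fun c => comap_pi_le fun s => h.measurable c s
  have hE' : P (⋂ c, E c) = ∏ c, P (E c) := by
    simpa using hind.meas_biInter (S := Finset.univ) (fun c _ => hEm c)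
  have hone : ∀ c (A : Set Ω), MeasurableSet[pastOf (N c) t] A → P (A ∩ E c) = P A * P (E c) := by
    intro c A hA
    have h1 := indepFun_past_increment (P := P) (h.measurable c) (h.zero c) (h.monotone c)
      (h.indepIncrements c) (le_self_add : t ≤ t + u c)
    have h2 : E c = (fun ω => N c (t + u c) ω - N c t ω) ⁻¹' {0} := by
      ext ω
      have := h.monotone c ω (le_self_add : t ≤ t + u c)
      simp only [hE, Set.mem_ofPred_eq, Set.mem_preimage, Set.mem_singleton_iff] at *
      omega
    rw [IndepFun_iff_Indep] at h1
    exact (Indep_iff _ _ _).1 h1 A (E c) hA ⟨{0}, measurableSet_singleton _, h2.symm⟩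
  -- Finite intersections of past events of single counters form a π-system generating the past. On
  -- such an intersection the probability factors over the counters, and within each counter by
  -- independent increments.
  have hIS : IndepSets (piiUnionInter (fun c => {s | MeasurableSet[pastOf (N c) t] s}) Set.univ)
      {⋂ c, E c} P := by
    rw [IndepSets_iff]
    rintro A B ⟨S, -, f, hf, rfl⟩ rfl
    set g : C → Set Ω := fun c => if c ∈ S then f c else Set.univ with hg
    have hgm : ∀ c, MeasurableSet[pastOf (N c) t] (g c) := by
      intro c
      by_cases hc : c ∈ S
      · simp only [hg, hc, if_true]; exact hf c hc
      · simp only [hg, hc, if_false]; exact MeasurableSet.univ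
    have hgS : ⋂ c ∈ S, f c = ⋂ c, g c := by
      ext ω
      simp only [Set.mem_iInter, hg]
      refine forall_congr' fun c => ?_
      by_cases hc : c ∈ S <;> simp [hc]
    have hgi : P (⋂ c, g c) = ∏ c, P (g c) := by
      simpa using hind.meas_biInter (S := Finset.univ) (fun c _ => hpast c _ (hgm c))
    have hgE : P (⋂ c, (g c ∩ E c)) = ∏ c, P (g c ∩ E c) := by
      simpa using hind.meas_biInter (S := Finset.univ)
        (fun c _ => (hpast c _ (hgm c)).inter (hEm c))
    rw [hgS, ← Set.iInter_inter_distrib, hgE, hgi, hE', ← Finset.prod_mul_distrib]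
    exact Finset.prod_congr rfl fun c _ => hone c _ (hgm c)
  have hI := IndepSets.indep (μ := P) (m1 := past N t)
    (m2 := MeasurableSpace.generateFrom {⋂ c, E c}) (h.past_le t)
    (MeasurableSpace.generateFrom_le (by
      rintro _ rfl; exact MeasurableSet.iInter fun c => hpathle c _ (hEm c)))
    (isPiSystem_piiUnionInter _
      (fun c => @MeasurableSpace.isPiSystem_measurableSet _ (pastOf (N c) t)) _)
    (IsPiSystem.singleton _)
    (by rw [generateFrom_piiUnionInter_measurableSet (fun c => pastOf (N c) t)]; simp [past])
    rfl hIS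
  rw [hEset, (Indep_iff _ _ _).1 hI F _ hF (MeasurableSpace.measurableSet_generateFrom rfl), hE']
  simp only [hE, h.measure_noJump]

end IsPoissonFamily

end Family

/-! ### Stopping times and the strong Markov property -/

/-- An integer-valued right-continuous path is constant just to the right of every point, so the
infimum is attained. The bound `hub` excludes the default value sInf ∅ = 0. Hitting times are
handled through this equivalence from here on. -/
lemma sInf_le_iff_of_rightContinuous {f : ℝ≥0 → ℕ} (hmono : Monotone f)
    (hrc : ∀ t, ∀ᶠ s in 𝓝[≥] t, f s = f t) {a : ℕ} (hub : ∃ t, a ≤ f t) (t : ℝ≥0) :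
    sInf {t | a ≤ f t} ≤ t ↔ a ≤ f t := by
  refine ⟨fun h => ?_, fun h => csInf_le (OrderBot.bddBelow _) h⟩
  refine le_trans ?_ (hmono h)
  by_contra hlt
  have h1 := hrc (sInf {t | a ≤ f t})
  obtain ⟨u, hu, hu'⟩ := mem_nhdsGE_iff_exists_Ico_subset.1 h1
  obtain ⟨v, hv, hvu⟩ := exists_lt_of_csInf_lt hub hu
  have h2 : f v = f (sInf {t | a ≤ f t}) := hu' ⟨csInf_le (OrderBot.bddBelow _) hv, hvu⟩
  rw [← h2] at hlt
  exact hlt hv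

/-- The time from `t` to the next jump of the counter `N` after `t`. -/
noncomputable def gap {Ω : Type*} (N : ℝ≥0 → Ω → ℕ) (t : ℝ≥0) (ω : Ω) : ℝ≥0 :=
  sInf {u | N t ω + 1 ≤ N (t + u) ω}

/-- `τ` is a stopping time for the history of the family `N`. -/
def IsStop {Ω C : Type*} (N : C → ℝ≥0 → Ω → ℕ) (τ : Ω → ℝ≥0) : Prop :=
  ∀ t, MeasurableSet[past N t] {ω | τ ω ≤ t}

/-- The events of the family `N` up to the stopping time `τ`. -/
@[reducible]
def stoppedPast {Ω C : Type*} (N : C → ℝ≥0 → Ω → ℕ) (τ : Ω → ℝ≥0) (hτ : IsStop N τ) :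
    MeasurableSpace Ω where
  MeasurableSet' F := ∀ t, MeasurableSet[past N t] (F ∩ {ω | τ ω ≤ t})
  measurableSet_empty t := by rw [Set.empty_inter]; exact @MeasurableSet.empty _ (past N t)
  measurableSet_compl F hF t := by
    have : Fᶜ ∩ {ω | τ ω ≤ t} = {ω | τ ω ≤ t} \ (F ∩ {ω | τ ω ≤ t}) := by
      ext ω; simp only [Set.mem_inter_iff, Set.mem_compl_iff, Set.mem_sdiff]; tauto
    rw [this]
    exact (hτ t).diff (hF t)
  measurableSet_iUnion f hf t := by
    rw [Set.iUnion_inter]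
    exact MeasurableSet.iUnion fun i => hf i t

lemma measurable_apply_of_countable {Ω : Type*} [MeasurableSpace Ω] {f : ℕ → Ω → ℕ}
    (hf : ∀ i, Measurable (f i)) {g : Ω → ℕ} (hg : Measurable g) :
    Measurable fun ω => f (g ω) ω :=
  (measurable_from_prod_countable_right (f := fun p : ℕ × Ω => f p.1 p.2) hf).comp
    (hg.prodMk measurable_id)

section Stop

variable {Ω C : Type*} {N : C → ℝ≥0 → Ω → ℕ} {σ τ : Ω → ℝ≥0}

protected lemma IsStop.min (hσ : IsStop N σ) (hτ : IsStop N τ) : IsStop N (fun ω => Min.min (σ ω) (τ ω)) := by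
  intro t
  have : {ω | Min.min (σ ω) (τ ω) ≤ t} = {ω | σ ω ≤ t} ∪ {ω | τ ω ≤ t} := by ext; simp
  rw [this]
  exact (hσ t).union (hτ t)

protected lemma IsStop.max (hσ : IsStop N σ) (hτ : IsStop N τ) :
    IsStop N (fun ω => Max.max (σ ω) (τ ω)) := by
  intro t
  have : {ω | Max.max (σ ω) (τ ω) ≤ t} = {ω | σ ω ≤ t} ∩ {ω | τ ω ≤ t} := by ext; simp
  rw [this]
  exact (hσ t).inter (hτ t)

lemma IsStop.measurable (hσ : IsStop N σ) (hτ : IsStop N τ) (hle : ∀ ω, σ ω ≤ τ ω) :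
    Measurable[stoppedPast N τ hτ] σ := by
  let _ := stoppedPast N τ hτ
  refine measurable_of_Iic fun u => ?_
  intro t
  have : σ ⁻¹' Set.Iic u ∩ {ω | τ ω ≤ t} = {ω | σ ω ≤ Min.min u t} ∩ {ω | τ ω ≤ t} := by
    ext ω
    simp only [Set.mem_inter_iff, Set.mem_preimage, Set.mem_Iic, Set.mem_ofPred_eq, le_min_iff]
    exact ⟨fun h => ⟨⟨h.1, (hle ω).trans h.2⟩, h.2⟩, fun h => ⟨h.1.1, h.2⟩⟩
  rw [this]
  exact (past_mono N (min_le_right u t) _ (hσ _)).inter (hτ t)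

lemma stoppedPast_mono (hσ : IsStop N σ) (hτ : IsStop N τ) (hle : ∀ ω, σ ω ≤ τ ω) :
    stoppedPast N σ hσ ≤ stoppedPast N τ hτ := by
  intro F hF t
  have : F ∩ {ω | τ ω ≤ t} = F ∩ {ω | σ ω ≤ t} ∩ {ω | τ ω ≤ t} := by
    ext ω
    simp only [Set.mem_inter_iff, Set.mem_ofPred_eq]
    exact ⟨fun h => ⟨⟨h.1, (hle ω).trans h.2⟩, h.2⟩, fun h => ⟨h.1.1, h.2⟩⟩
  rw [this]
  exact (hF t).inter (hτ t)

end Stop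

/-- The least multiple of `1 / (q + 1)` that is at least `t`. -/
noncomputable def gridCeil (q : ℕ) (t : ℝ≥0) : ℝ≥0 := ⌈(q + 1 : ℝ≥0) * t⌉₊ / (q + 1 : ℝ≥0)

lemma le_gridCeil (q : ℕ) (t : ℝ≥0) : t ≤ gridCeil q t := by
  rw [gridCeil, le_div_iff₀ (by positivity), mul_comm]
  exact Nat.le_ceil _

/-- The approximation is from the right, which is the side on which the paths are continuous. -/
lemma tendsto_gridCeil (t : ℝ≥0) : Tendsto (fun q => gridCeil q t) atTop (𝓝[≥] t) := by
  refine tendsto_nhdsWithin_iff.2 ⟨?_, Eventually.of_forall fun q => le_gridCeil q t⟩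
  have h2 : Tendsto (fun q : ℕ => t + 1 / ((q : ℝ≥0) + 1)) atTop (𝓝 t) := by
    simpa using (tendsto_const_nhds (x := t)).add
      (tendsto_one_div_add_atTop_nhds_zero_nat (𝕜 := ℝ≥0))
  refine tendsto_of_tendsto_of_tendsto_of_le_of_le tendsto_const_nhds h2
    (fun q => le_gridCeil q t) fun q => ?_
  have h3 := (Nat.ceil_lt_add_one (zero_le (a := (q + 1 : ℝ≥0) * t))).le
  simp only [gridCeil]
  rw [div_le_iff₀ (by positivity)]
  refine h3.trans_eq ?_
  field_simp

section Family

variable {Ω C : Type*} {mΩ : MeasurableSpace Ω} {P : Measure Ω} {N : C → ℝ≥0 → Ω → ℕ}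
  {r : C → ℝ≥0} {τ : Ω → ℝ≥0}

namespace IsPoissonFamily

lemma arrivalTime_le_iff (h : IsPoissonFamily P N r) (c : C) (a : ℕ) (ω : Ω) (t : ℝ≥0) :
    arrivalTime (N c) a ω ≤ t ↔ a ≤ N c t ω :=
  sInf_le_iff_of_rightContinuous (h.monotone c ω) (h.rightContinuous c ω) (h.unbounded c ω a) t

lemma gap_le_iff (h : IsPoissonFamily P N r) (c : C) (t : ℝ≥0) (ω : Ω) (u : ℝ≥0) :
    gap (N c) t ω ≤ u ↔ N c t ω < N c (t + u) ω := by
  refine sInf_le_iff_of_rightContinuous (f := fun u => N c (t + u) ω)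
    (fun a b hab => h.monotone c ω (by gcongr)) (fun u => ?_) ?_ u
  · have h1 : Tendsto (fun s => t + s) (𝓝[≥] u) (𝓝[≥] (t + u)) := by
      refine tendsto_nhdsWithin_iff.2 ⟨?_, ?_⟩
      · exact (tendsto_const_nhds.add tendsto_id).mono_left nhdsWithin_le_nhds
      · filter_upwards [self_mem_nhdsWithin] with s hs
        exact add_le_add le_rfl (Set.mem_Ici.1 hs)
    exact h1.eventually (h.rightContinuous c ω (t + u))
  · obtain ⟨s, hs⟩ := h.unbounded c ω (N c t ω + 1)
    exact ⟨s, hs.trans (h.monotone c ω le_add_self)⟩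

lemma lt_gap_iff (h : IsPoissonFamily P N r) (c : C) (t : ℝ≥0) (ω : Ω) (u : ℝ≥0) :
    u < gap (N c) t ω ↔ N c (t + u) ω = N c t ω := by
  rw [← not_le, h.gap_le_iff, not_lt]
  exact ⟨fun h' => le_antisymm h' (h.monotone c ω le_self_add), fun h' => h'.le⟩

lemma gap_pos (h : IsPoissonFamily P N r) (c : C) (t : ℝ≥0) (ω : Ω) : 0 < gap (N c) t ω := by
  rw [h.lt_gap_iff, add_zero]

lemma isStop_arrivalTime (h : IsPoissonFamily P N r) (c : C) (a : ℕ) :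
    IsStop N (arrivalTime (N c) a) := by
  intro t
  simp only [h.arrivalTime_le_iff]
  exact measurable_past N c le_rfl measurableSet_Ici

lemma isStop_add_gap (h : IsPoissonFamily P N r) (hτ : IsStop N τ) (c : C) :
    IsStop N (fun ω => τ ω + gap (N c) (τ ω) ω) := by
  intro t
  -- A countable description: the counter increases between some rational q ≥ τ and t. Such a q
  -- exists because the path stays constant for a short while after τ.
  have : {ω | τ ω + gap (N c) (τ ω) ω ≤ t} =
      ⋃ q : ℚ, ⋃ _ : Real.toNNReal q ≤ t,
        ({ω | τ ω ≤ Real.toNNReal q} ∩ {ω | N c (Real.toNNReal q) ω < N c t ω}) := by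
    ext ω
    simp only [Set.mem_iUnion, Set.mem_inter_iff, Set.mem_ofPred_eq, exists_prop]
    constructor
    · intro hle
      have h1 : τ ω < t := lt_of_lt_of_le (lt_add_of_pos_right _ (h.gap_pos c _ ω)) hle
      obtain ⟨v, hv, hv'⟩ := mem_nhdsGE_iff_exists_Ico_subset.1 (h.rightContinuous c ω (τ ω))
      obtain ⟨q, hq1, hq2⟩ := exists_rat_btwn (NNReal.coe_lt_coe.2 (lt_min h1 hv))
      have hq1' : τ ω ≤ Real.toNNReal q := by
        rw [← NNReal.coe_le_coe]; exact hq1.le.trans (Real.le_coe_toNNReal _)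
      have hq2' : Real.toNNReal q < min t v := by
        rw [← NNReal.coe_lt_coe, Real.coe_toNNReal _ ((τ ω).2.trans hq1.le)]; exact hq2
      refine ⟨q, (hq2'.trans_le (min_le_left _ _)).le, hq1', ?_⟩
      have h2 : N c (Real.toNNReal q) ω = N c (τ ω) ω :=
        hv' ⟨hq1', hq2'.trans_le (min_le_right _ _)⟩
      rw [h2]
      have h3 := (h.gap_le_iff c (τ ω) ω (t - τ ω)).1 (le_tsub_of_add_le_left hle)
      rwa [add_tsub_cancel_of_le h1.le] at h3
    · rintro ⟨q, hqt, h1, h2⟩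
      have h3 : τ ω ≤ t := h1.trans hqt
      have h4 := (h.gap_le_iff c (τ ω) ω (t - τ ω)).2 (by
        rw [add_tsub_cancel_of_le h3]
        exact (h.monotone c ω h1).trans_lt h2)
      calc τ ω + gap (N c) (τ ω) ω ≤ τ ω + (t - τ ω) := by gcongr
        _ = t := add_tsub_cancel_of_le h3
  rw [this]
  refine MeasurableSet.iUnion fun q => MeasurableSet.iUnion fun hq => ?_
  exact (past_mono N hq _ (hτ _)).inter
    (measurableSet_lt (measurable_past N c hq) (measurable_past N c le_rfl))

lemma measurable_of_isStop (h : IsPoissonFamily P N r) (hτ : IsStop N τ) : Measurable τ :=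
  measurable_of_Iic fun t => h.past_le t _ (hτ t)

lemma stoppedPast_le (h : IsPoissonFamily P N r) (hτ : IsStop N τ) : stoppedPast N τ hτ ≤ mΩ := by
  intro F hF
  have : F = ⋃ n : ℕ, (F ∩ {ω | τ ω ≤ n}) := by
    rw [← Set.inter_iUnion]
    refine (Set.inter_eq_left.2 fun ω _ => ?_).symm
    obtain ⟨n, hn⟩ := exists_nat_ge (τ ω)
    exact Set.mem_iUnion.2 ⟨n, hn⟩
  rw [this]
  exact MeasurableSet.iUnion fun n => h.past_le n _ (hF n)

lemma tendsto_gridCeil_add (h : IsPoissonFamily P N r) (c : C) (t u : ℝ≥0) (ω : Ω) :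
    ∀ᶠ q in atTop, N c (gridCeil q t + u) ω = N c (t + u) ω := by
  have h1 : Tendsto (fun q => gridCeil q t + u) atTop (𝓝[≥] (t + u)) := by
    refine tendsto_nhdsWithin_iff.2 ⟨?_, Eventually.of_forall fun q => ?_⟩
    · exact ((tendsto_nhdsWithin_iff.1 (tendsto_gridCeil t)).1).add tendsto_const_nhds
    · exact add_le_add (le_gridCeil q t) le_rfl
  exact h1.eventually (h.rightContinuous c ω (t + u))

lemma measurable_gridCeil_add (h : IsPoissonFamily P N r) (hτ : Measurable τ) (c : C) (q : ℕ)
    (u : ℝ≥0) : Measurable fun ω => N c (gridCeil q (τ ω) + u) ω := by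
  exact measurable_apply_of_countable (f := fun i ω => N c (i / (q + 1 : ℝ≥0) + u) ω)
    (fun i => h.measurable c _) (Nat.measurable_ceil.comp (measurable_const.mul hτ))

lemma measurable_stopped (h : IsPoissonFamily P N r) (hτ : Measurable τ) (c : C) (u : ℝ≥0) :
    Measurable fun ω => N c (τ ω + u) ω := by
  refine measurable_of_tendsto_metrizable (fun q => h.measurable_gridCeil_add hτ c q u) ?_
  refine tendsto_pi_nhds.2 fun ω => ?_
  exact tendsto_nhds_of_eventually_eq (h.tendsto_gridCeil_add c (τ ω) u ω)

lemma measurable_gap (h : IsPoissonFamily P N r) (hτ : Measurable τ) (c : C) :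
    Measurable fun ω => gap (N c) (τ ω) ω := by
  refine measurable_of_Iic fun u => ?_
  have : (fun ω => gap (N c) (τ ω) ω) ⁻¹' Set.Iic u = {ω | N c (τ ω) ω < N c (τ ω + u) ω} := by
    ext ω; simp [h.gap_le_iff]
  rw [this]
  have h0 := h.measurable_stopped hτ c 0
  simp only [add_zero] at h0
  exact measurableSet_lt h0 (h.measurable_stopped hτ c u)

/-- Strong Markov property. -/
lemma measure_inter_lt_gap [Fintype C] [IsProbabilityMeasure P] (h : IsPoissonFamily P N r)
    (hτ : IsStop N τ) (u : C → ℝ≥0) {F : Set Ω} (hF : MeasurableSet[stoppedPast N τ hτ] F) :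
    P (F ∩ {ω | ∀ c, u c < gap (N c) (τ ω) ω}) =
      P F * ∏ c, ENNReal.ofReal (Real.exp (-(r c * u c))) := by
  have hτm := h.measurable_of_isStop hτ
  have hFm := h.stoppedPast_le hτ _ hF
  have hgm : ∀ q c u, Measurable fun ω => N c (gridCeil q (τ ω) + u) ω :=
    fun q c u => h.measurable_gridCeil_add hτm c q u
  have hgm0 : ∀ q c, Measurable fun ω => N c (gridCeil q (τ ω)) ω := fun q c => by
    simpa only [add_zero] using hgm q c 0
  -- τ is replaced by its grid ceiling, which takes countably many values. The event for the ceiling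
  -- has the claimed probability for every q, and its indicator is eventually that of the event for
  -- τ.
  set A : ℕ → Set Ω := fun q =>
    F ∩ {ω | ∀ c, N c (gridCeil q (τ ω) + u c) ω = N c (gridCeil q (τ ω)) ω} with hA
  have hlim : Tendsto (fun q => P (A q)) atTop
      (𝓝 (P (F ∩ {ω | ∀ c, u c < gap (N c) (τ ω) ω}))) := by
    refine tendsto_measure_of_ae_tendsto_indicator_of_isFiniteMeasure atTop ?_ ?_ ?_
    · refine hFm.inter ?_
      rw [Set.ofPred_forall]
      exact MeasurableSet.iInter fun c => measurableSet_lt measurable_const (h.measurable_gap hτm c)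
    · intro q
      refine hFm.inter ?_
      rw [Set.ofPred_forall]
      exact MeasurableSet.iInter fun c => measurableSet_eq_fun (hgm q c _) (hgm0 q c)
    · refine ae_of_all _ fun ω => ?_
      have h1 : ∀ᶠ q in atTop, ∀ c, N c (gridCeil q (τ ω) + u c) ω = N c (τ ω + u c) ω :=
        eventually_all.2 fun c => h.tendsto_gridCeil_add c _ _ ω
      have h2 : ∀ᶠ q in atTop, ∀ c, N c (gridCeil q (τ ω)) ω = N c (τ ω) ω :=
        eventually_all.2 fun c => by simpa using h.tendsto_gridCeil_add c (τ ω) 0 ω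
      filter_upwards [h1, h2] with q h1 h2
      simp only [hA, Set.mem_inter_iff, Set.mem_ofPred_eq, h1, h2, h.lt_gap_iff]
  have hval : ∀ q, P (A q) = P F * ∏ c, ENNReal.ofReal (Real.exp (-(r c * u c))) := by
    intro q
    -- On `B i` the ceiling of τ is the fixed time `g i`, and `F ∩ B i` belongs to the past of `g
    -- i`, so the Markov property at a fixed time applies to each piece.
    set B : ℕ → Set Ω := fun i => {ω | ⌈(q + 1 : ℝ≥0) * τ ω⌉₊ = i} with hB
    set g : ℕ → ℝ≥0 := fun i => i / (q + 1 : ℝ≥0) with hg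
    have hq : (0 : ℝ≥0) < q + 1 := by positivity
    have hle : ∀ i, {ω | ⌈(q + 1 : ℝ≥0) * τ ω⌉₊ ≤ i} = {ω | τ ω ≤ g i} := by
      intro i
      ext ω
      simp only [Set.mem_ofPred_eq, Nat.ceil_le, hg, le_div_iff₀ hq, mul_comm]
    have hgmono : Monotone g := fun i i' hii => by
      simp only [hg]; gcongr
    have hFB : ∀ i, MeasurableSet[past N (g i)] (F ∩ B i) := by
      intro i
      have : F ∩ B i = (F ∩ {ω | τ ω ≤ g i}) \ ⋃ i' : ℕ, ⋃ _ : i' < i, {ω | τ ω ≤ g i'} := by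
        ext ω
        simp only [← hle, hB, Set.mem_inter_iff, Set.mem_ofPred_eq, Set.mem_sdiff, Set.mem_iUnion,
          exists_prop, not_exists, not_and, not_le]
        constructor
        · rintro ⟨h1, h2⟩
          exact ⟨⟨h1, h2.le⟩, fun i' hi' => by omega⟩
        · rintro ⟨⟨h1, h2⟩, h3⟩
          refine ⟨h1, le_antisymm h2 ?_⟩
          by_contra h4
          exact absurd (h3 _ (not_le.1 h4)) (lt_irrefl _)
      rw [this]
      exact (hF (g i)).diff (MeasurableSet.iUnion fun i' => MeasurableSet.iUnion fun hi' =>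
        past_mono N (hgmono hi'.le) _ (hτ _))
    have hdisj : Pairwise (Function.onFun Disjoint B) := fun i i' hii =>
      Set.disjoint_left.2 fun ω h1 h2 => hii (h1.symm.trans h2)
    have hBU : ⋃ i, B i = Set.univ := Set.eq_univ_of_forall fun ω => Set.mem_iUnion.2 ⟨_, rfl⟩
    have hBm : ∀ i, MeasurableSet (B i) := fun i =>
      (Nat.measurable_ceil.comp (measurable_const.mul hτm)) (measurableSet_singleton i)
    have hsum : ∀ S : Set Ω, MeasurableSet S → P S = ∑' i, P (S ∩ B i) := by
      intro S hS
      rw [← measure_iUnion (fun i i' hii => (hdisj hii).mono Set.inter_subset_right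
        Set.inter_subset_right) (fun i => hS.inter (hBm i)), ← Set.inter_iUnion, hBU,
        Set.inter_univ]
    have hAm : MeasurableSet (A q) := by
      refine hFm.inter ?_
      rw [Set.ofPred_forall]
      exact MeasurableSet.iInter fun c => measurableSet_eq_fun (hgm q c _) (hgm0 q c)
    rw [hsum _ hAm, hsum F hFm, ← ENNReal.tsum_mul_right]
    refine tsum_congr fun i => ?_
    rw [← h.measure_inter_noJump u (hFB i)]
    congr 1
    ext ω
    simp only [hA, hB, Set.mem_inter_iff, Set.mem_ofPred_eq, gridCeil, hg]
    constructor
    · rintro ⟨⟨h1, h2⟩, h3⟩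
      rw [h3] at h2
      exact ⟨⟨h1, h3⟩, h2⟩
    · rintro ⟨⟨h1, h3⟩, h2⟩
      refine ⟨⟨h1, ?_⟩, h3⟩
      rw [h3]
      exact h2
  exact tendsto_nhds_unique hlim (by simp only [hval]; exact tendsto_const_nhds)

end IsPoissonFamily

end Family

/-! ### Exponential law of the waiting times -/

lemma expMeasure_Ioi {r : ℝ} (hr : 0 < r) (t : ℝ) :
    expMeasure r (Set.Ioi t) = ENNReal.ofReal (Real.exp (-(r * t.toNNReal))) := by
  have := isProbabilityMeasure_expMeasure hr
  have h1 : (expMeasure r).real (Set.Ioi t) = Real.exp (-(r * t.toNNReal)) := by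
    rw [← Set.compl_Iic, probReal_compl_eq_one_sub measurableSet_Iic, ← cdf_eq_real,
      cdf_expMeasure_eq hr]
    split_ifs with ht
    · rw [Real.coe_toNNReal _ ht]; ring
    · rw [Real.toNNReal_of_nonpos (not_le.1 ht).le]; simp
  rw [← h1, ofReal_measureReal]

/-- The law of independent exponential variables with rates `r`. -/
noncomputable def expPi {C : Type*} [Fintype C] (r : C → ℝ≥0) : Measure (C → ℝ) :=
  Measure.pi fun c => expMeasure (r c)

/-- Open upper half-lines form a π-system that generates the Borel sets, so a joint survival
function determines the law. -/
lemma expPi_eq_of_Ioi {C : Type*} [Fintype C] {r : C → ℝ≥0} (hr : ∀ c, 0 < r c)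
    {ν : Measure (C → ℝ)} (h : ∀ t : C → ℝ, ν (Set.univ.pi fun c => Set.Ioi (t c)) =
      ∏ c, ENNReal.ofReal (Real.exp (-(r c * (t c).toNNReal)))) : expPi r = ν := by
  have := fun c => isProbabilityMeasure_expMeasure (NNReal.coe_pos.2 (hr c))
  refine Measure.pi_eq_generateFrom (C := fun _ => Set.range Set.Ioi)
    (fun c => ?_) (fun c => isPiSystem_Ioi) (fun c => ?_) fun s hs => ?_
  · rw [← borel_eq_generateFrom_Ioi]; exact (BorelSpace.measurable_eq).symm
  · exact ⟨fun n => Set.Ioi (-(n : ℝ)), fun n => ⟨_, rfl⟩, fun n => measure_lt_top _ _,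
      Set.eq_univ_of_forall fun x => by
        obtain ⟨n, hn⟩ := exists_nat_gt (-x)
        exact Set.mem_iUnion.2 ⟨n, by simp only [Set.mem_Ioi]; linarith⟩⟩
  · choose t ht using hs
    obtain rfl : s = fun c => Set.Ioi (t c) := funext fun c => (ht c).symm
    rw [h t]
    exact Finset.prod_congr rfl fun c _ => (expMeasure_Ioi (NNReal.coe_pos.2 (hr c)) _).symm

section Family

variable {Ω C : Type*} {mΩ : MeasurableSpace Ω} {P : Measure Ω} {N : C → ℝ≥0 → Ω → ℕ}
  {r : C → ℝ≥0} {τ : Ω → ℝ≥0}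

/-- The waiting times from `τ` to the next jumps of the counters. -/
noncomputable def gaps (N : C → ℝ≥0 → Ω → ℕ) (τ : Ω → ℝ≥0) (ω : Ω) (c : C) : ℝ :=
  gap (N c) (τ ω) ω

namespace IsPoissonFamily

lemma measurable_gaps (h : IsPoissonFamily P N r) (hτ : IsStop N τ) : Measurable (gaps N τ) :=
  measurable_pi_lambda _ fun c =>
    (h.measurable_gap (h.measurable_of_isStop hτ) c).coe_nnreal_real

lemma measure_inter_gaps_mem [Fintype C] [IsProbabilityMeasure P] (h : IsPoissonFamily P N r)
    (hτ : IsStop N τ) {F : Set Ω} (hF : MeasurableSet[stoppedPast N τ hτ] F) {S : Set (C → ℝ)}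
    (hS : MeasurableSet S) : P (F ∩ gaps N τ ⁻¹' S) = P F * expPi r S := by
  rcases eq_or_ne (P F) 0 with h0 | h0
  · rw [h0, zero_mul]; exact measure_mono_null Set.inter_subset_left h0
  have hW := h.measurable_gaps hτ
  -- The right side is the conditional law of the waiting times given F; the strong Markov property
  -- computes its survival function. Negative thresholds may be raised to 0 because waiting times
  -- are positive.
  have key : expPi r = (P F)⁻¹ • (P.restrict F).map (gaps N τ) := by
    refine expPi_eq_of_Ioi h.rate_pos fun t => ?_
    rw [Measure.smul_apply, Measure.map_apply hW (MeasurableSet.univ_pi fun _ => measurableSet_Ioi),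
      Measure.restrict_apply (hW (MeasurableSet.univ_pi fun _ => measurableSet_Ioi)), Set.inter_comm]
    have : gaps N τ ⁻¹' (Set.univ.pi fun c => Set.Ioi (t c)) =
        {ω | ∀ c, (t c).toNNReal < gap (N c) (τ ω) ω} := by
      ext ω
      simp only [Set.mem_preimage, Set.mem_univ_pi, Set.mem_Ioi, gaps, Set.mem_ofPred_eq]
      refine forall_congr' fun c => ?_
      rw [← NNReal.coe_lt_coe, Real.coe_toNNReal', max_lt_iff]
      exact (and_iff_left (NNReal.coe_pos.2 (h.gap_pos c _ ω))).symm
    rw [this, h.measure_inter_lt_gap hτ _ hF, smul_eq_mul, ← mul_assoc,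
      ENNReal.inv_mul_cancel h0 (measure_ne_top _ _), one_mul]
  rw [key, Measure.smul_apply, Measure.map_apply hW hS, Measure.restrict_apply (hW hS),
    smul_eq_mul, ← mul_assoc, ENNReal.mul_inv_cancel h0 (measure_ne_top _ _), one_mul,
    Set.inter_comm]

lemma map_gaps [Fintype C] [IsProbabilityMeasure P] (h : IsPoissonFamily P N r)
    (hτ : IsStop N τ) : P.map (gaps N τ) = expPi r := by
  ext S hS
  rw [Measure.map_apply (h.measurable_gaps hτ) hS]
  simpa using h.measure_inter_gaps_mem hτ MeasurableSet.univ hS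

lemma indep_gaps [Fintype C] [IsProbabilityMeasure P] (h : IsPoissonFamily P N r)
    (hτ : IsStop N τ) :
    Indep (stoppedPast N τ hτ) (MeasurableSpace.comap (gaps N τ) inferInstance) P := by
  rw [Indep_iff]
  rintro F _ hF ⟨S, hS, rfl⟩
  rw [h.measure_inter_gaps_mem hτ hF hS, ← h.map_gaps hτ,
    Measure.map_apply (h.measurable_gaps hτ) hS]

end IsPoissonFamily

end Family

/-! ### Law of large numbers for orthogonal variables -/

section OrthogonalLLN

variable {Ω : Type*} {mΩ : MeasurableSpace Ω} {P : Measure Ω}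

/-- The expectations of the squares are summable, so the sum of the squares is almost surely finite
and its terms tend to 0. -/
lemma ae_tendsto_zero_of_integral_sq_le {f : ℕ → Ω → ℝ} {K : ℝ}
    (hf : ∀ n, MemLp (f n) 2 P) (h : ∀ n, ∫ ω, f n ω ^ 2 ∂P ≤ K / ((n : ℝ) + 1) ^ 2) :
    ∀ᵐ ω ∂P, Tendsto (fun n => f n ω) atTop (𝓝 0) := by
  have hsum : Summable fun n : ℕ => K / ((n : ℝ) + 1) ^ 2 := by
    have h1 := (summable_nat_add_iff 1).2 (Real.summable_one_div_nat_pow.2 (by norm_num : 1 < 2))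
    have h2 := h1.mul_left K
    refine h2.congr fun n => ?_
    push_cast
    ring
  have hm : ∀ n, AEMeasurable (fun ω => ENNReal.ofReal (f n ω ^ 2)) P := fun n =>
    ((hf n).1.aemeasurable.pow_const 2).ennreal_ofReal
  have hfin : ∫⁻ ω, ∑' n, ENNReal.ofReal (f n ω ^ 2) ∂P ≠ ∞ := by
    rw [lintegral_tsum hm]
    refine ne_top_of_le_ne_top hsum.tsum_ofReal_ne_top (ENNReal.tsum_le_tsum fun n => ?_)
    rw [← ofReal_integral_eq_lintegral_ofReal (hf n).integrable_sq (ae_of_all _ fun ω => sq_nonneg _)]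
    exact ENNReal.ofReal_le_ofReal (h n)
  filter_upwards [ae_lt_top' (AEMeasurable.tsum hm) hfin] with ω hω
  have h1 := ENNReal.tendsto_atTop_zero_of_tsum_ne_top hω.ne
  have h2 : Tendsto (fun n => f n ω ^ 2) atTop (𝓝 0) := by
    have := (ENNReal.tendsto_toReal ENNReal.zero_ne_top).comp h1
    simpa [Function.comp_def, ENNReal.toReal_ofReal, sq_nonneg] using this
  have h3 := (Real.continuous_sqrt.tendsto 0).comp h2
  simp only [Real.sqrt_zero, Function.comp_def, Real.sqrt_sq_eq_abs] at h3
  exact (tendsto_zero_iff_abs_tendsto_zero _).2 h3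

lemma integral_sq_sum_of_orthogonal {Z : ℕ → Ω → ℝ} (hZ : ∀ n, MemLp (Z n) 2 P)
    (horth : ∀ m n, m < n → ∫ ω, Z m ω * Z n ω ∂P = 0) (n : ℕ) :
    ∫ ω, (∑ i ∈ Finset.range n, Z i ω) ^ 2 ∂P = ∑ i ∈ Finset.range n, ∫ ω, Z i ω ^ 2 ∂P := by
  induction n with
  | zero => simp
  | succ n ih =>
    have hS : MemLp (fun ω => ∑ i ∈ Finset.range n, Z i ω) 2 P := memLp_finsetSum _ fun i _ => hZ i
    have hc : ∀ i, Integrable (fun ω => Z i ω * Z n ω) P := fun i => (hZ i).integrable_mul (hZ n)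
    have h1 : ∀ ω, (∑ i ∈ Finset.range (n + 1), Z i ω) ^ 2 =
        (∑ i ∈ Finset.range n, Z i ω) ^ 2 + 2 * (∑ i ∈ Finset.range n, Z i ω * Z n ω)
          + Z n ω ^ 2 := fun ω => by
      rw [Finset.sum_range_succ, ← Finset.sum_mul]; ring
    have h2 : Integrable (fun ω => ∑ i ∈ Finset.range n, Z i ω * Z n ω) P :=
      integrable_finsetSum _ fun i _ => hc i
    simp_rw [h1]
    have h3 : Integrable (fun ω => (∑ i ∈ Finset.range n, Z i ω) ^ 2 +
        2 * (∑ i ∈ Finset.range n, Z i ω * Z n ω)) P := hS.integrable_sq.add (h2.const_mul 2)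
    rw [integral_add h3 (hZ n).integrable_sq,
      integral_add hS.integrable_sq (h2.const_mul 2), integral_const_mul,
      integral_finsetSum _ fun i _ => hc i, ih, Finset.sum_range_succ,
      Finset.sum_eq_zero fun i hi => horth i n (Finset.mem_range.1 hi)]
    ring

/-- Strong law of large numbers for orthogonal sequences that are bounded in `L²`. -/
theorem ae_tendsto_average_of_orthogonal {Z : ℕ → Ω → ℝ} {K : ℝ}
    (hZ : ∀ n, MemLp (Z n) 2 P) (hK : ∀ n, ∫ ω, Z n ω ^ 2 ∂P ≤ K)
    (horth : ∀ m n, m < n → ∫ ω, Z m ω * Z n ω ∂P = 0) :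
    ∀ᵐ ω ∂P, Tendsto (fun n : ℕ => (∑ i ∈ Finset.range n, Z i ω) / n) atTop (𝓝 0) := by
  have hK0 : 0 ≤ K := (integral_nonneg fun ω => sq_nonneg (Z 0 ω)).trans (hK 0)
  -- `V` is the average along the squares (q+1)², where orthogonality gives a second moment of at
  -- most K/(q+1)². `D` bounds what can be added before the next square.
  set V : ℕ → Ω → ℝ := fun q ω =>
    (∑ i ∈ Finset.range ((q + 1) ^ 2), Z i ω) / ((q : ℝ) + 1) ^ 2 with hV
  set D : ℕ → Ω → ℝ := fun q ω =>
    (∑ i ∈ Finset.Ico ((q + 1) ^ 2) ((q + 2) ^ 2), |Z i ω|) / ((q : ℝ) + 1) ^ 2 with hD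
  have hVlim : ∀ᵐ ω ∂P, Tendsto (fun n => V n ω) atTop (𝓝 0) := by
    refine ae_tendsto_zero_of_integral_sq_le (K := K) (fun q => ?_) fun q => ?_
    · simp only [hV, div_eq_mul_inv]
      exact (memLp_finsetSum _ fun i _ => hZ i).mul_const _
    · simp only [hV, div_pow]
      rw [integral_div, integral_sq_sum_of_orthogonal hZ horth]
      have h1 : ∑ i ∈ Finset.range ((q + 1) ^ 2), ∫ ω, Z i ω ^ 2 ∂P ≤ ((q : ℝ) + 1) ^ 2 * K := by
        refine (Finset.sum_le_sum fun i _ => hK i).trans_eq ?_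
        rw [Finset.sum_const, Finset.card_range, nsmul_eq_mul]
        push_cast; ring
      rw [div_le_div_iff₀ (by positivity) (by positivity)]
      calc _ ≤ ((q : ℝ) + 1) ^ 2 * K * ((q : ℝ) + 1) ^ 2 := by gcongr
        _ = _ := by ring
  have hDlim : ∀ᵐ ω ∂P, Tendsto (fun n => D n ω) atTop (𝓝 0) := by
    have hmem : ∀ q, MemLp (fun ω => ∑ i ∈ Finset.Ico ((q + 1) ^ 2) ((q + 2) ^ 2), |Z i ω|) 2 P :=
      fun q => memLp_finsetSum _ fun i _ => (hZ i).abs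
    -- A block between consecutive squares has 2q+3 ≤ 3(q+1) terms, and Cauchy–Schwarz squares this
    -- factor, whence the 9.
    refine ae_tendsto_zero_of_integral_sq_le (K := 9 * K) (fun q => ?_) fun q => ?_
    · simp only [hD, div_eq_mul_inv]
      exact (hmem q).mul_const _
    · simp only [hD, div_pow]
      rw [integral_div]
      have hcard : (((Finset.Ico ((q + 1) ^ 2) ((q + 2) ^ 2)).card : ℕ) : ℝ) = 2 * q + 3 := by
        rw [Nat.card_Ico, Nat.cast_sub (by gcongr; omega)]
        push_cast; ring
      have h1 : ∫ ω, (∑ i ∈ Finset.Ico ((q + 1) ^ 2) ((q + 2) ^ 2), |Z i ω|) ^ 2 ∂P ≤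
          (2 * q + 3) * ((2 * q + 3) * K) := by
        calc _ ≤ ∫ ω, (2 * q + 3) * ∑ i ∈ Finset.Ico ((q + 1) ^ 2) ((q + 2) ^ 2), Z i ω ^ 2 ∂P := by
              refine integral_mono (hmem q).integrable_sq
                ((integrable_finsetSum _ fun i _ => (hZ i).integrable_sq).const_mul _) fun ω => ?_
              have := sq_sum_le_card_mul_sum_sq (s := Finset.Ico ((q + 1) ^ 2) ((q + 2) ^ 2))
                (f := fun i => |Z i ω|)
              simpa only [hcard, sq_abs] using this
          _ = (2 * q + 3) * ∑ i ∈ Finset.Ico ((q + 1) ^ 2) ((q + 2) ^ 2), ∫ ω, Z i ω ^ 2 ∂P := by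
              rw [integral_const_mul, integral_finsetSum _ fun i _ => (hZ i).integrable_sq]
          _ ≤ _ := by
              gcongr
              refine (Finset.sum_le_sum fun i _ => hK i).trans_eq ?_
              rw [Finset.sum_const, nsmul_eq_mul, hcard]
      rw [div_le_div_iff₀ (by positivity) (by positivity)]
      calc _ ≤ ((2 * q + 3) * ((2 * q + 3) * K)) * ((q : ℝ) + 1) ^ 2 := by gcongr
        _ ≤ ((3 * (q + 1)) * ((3 * (q + 1)) * K)) * ((q : ℝ) + 1) ^ 2 := by
            gcongr <;> linarith [Nat.cast_nonneg (α := ℝ) q]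
        _ = _ := by ring
  filter_upwards [hVlim, hDlim] with ω hVω hDω
  have hsqrt : Tendsto (fun n => Nat.sqrt n - 1) atTop atTop := by
    refine tendsto_atTop.2 fun b => ?_
    filter_upwards [eventually_ge_atTop ((b + 1) ^ 2)] with n hn
    have : b + 1 ≤ Nat.sqrt n := Nat.le_sqrt'.2 hn
    omega
  have hlim : Tendsto (fun n => |V (Nat.sqrt n - 1) ω| + |D (Nat.sqrt n - 1) ω|) atTop (𝓝 0) := by
    have := ((hVω.comp hsqrt).abs).add ((hDω.comp hsqrt).abs)
    simpa [Function.comp_def] using this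
  refine squeeze_zero_norm' ?_ hlim
  filter_upwards [eventually_ge_atTop 1] with n hn
  obtain ⟨q, hq⟩ : ∃ q, Nat.sqrt n = q + 1 :=
    ⟨Nat.sqrt n - 1, by have : 1 ≤ Nat.sqrt n := Nat.le_sqrt'.2 (by simpa using hn); omega⟩
  have hq1 : (q + 1) ^ 2 ≤ n := by rw [← hq]; exact Nat.sqrt_le' n
  have hq2 : n < (q + 2) ^ 2 := by have := Nat.lt_succ_sqrt' n; rwa [hq] at this
  rw [hq, Nat.add_sub_cancel]
  have hn' : ((q : ℝ) + 1) ^ 2 ≤ n := by exact_mod_cast hq1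
  have hpos : (0 : ℝ) < ((q : ℝ) + 1) ^ 2 := by positivity
  simp only [hV, hD, abs_div, abs_of_pos hpos, Real.norm_eq_abs, Nat.abs_cast]
  rw [← add_div]
  refine div_le_div₀ (by positivity) ?_ hpos hn'
  rw [← Finset.sum_range_add_sum_Ico _ hq1]
  refine (abs_add_le _ _).trans (add_le_add le_rfl ?_)
  refine (Finset.abs_sum_le_sum_abs _ _).trans (le_trans ?_ (le_abs_self _))
  exact Finset.sum_le_sum_of_subset_of_nonneg (Finset.Ico_subset_Ico le_rfl hq2.le)
    fun i _ _ => abs_nonneg _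

end OrthogonalLLN

/-! ### Independent exponential variables -/

section ExpPi

variable {C : Type*} [Fintype C] {r : C → ℝ≥0}

lemma isProbabilityMeasure_expPi (hr : ∀ c, 0 < r c) : IsProbabilityMeasure (expPi r) := by
  have := fun c => isProbabilityMeasure_expMeasure (NNReal.coe_pos.2 (hr c))
  unfold expPi; infer_instance

lemma map_eval_expPi (hr : ∀ c, 0 < r c) (c : C) :
    (expPi r).map (fun w => w c) = expMeasure (r c) := by
  have := fun c => isProbabilityMeasure_expMeasure (NNReal.coe_pos.2 (hr c))
  exact (measurePreserving_eval (fun c => expMeasure (r c)) c).map_eq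

lemma expMeasure_singleton (r x : ℝ) : expMeasure r {x} = 0 :=
  withDensity_absolutelyContinuous volume _ (measure_singleton x)

lemma ae_pos_expPi (hr : ∀ c, 0 < r c) (c : C) : ∀ᵐ w ∂expPi r, 0 < w c := by
  have := isProbabilityMeasure_expMeasure (NNReal.coe_pos.2 (hr c))
  have h1 : ∀ᵐ x ∂(expPi r).map (fun w => w c), 0 < x := by
    rw [map_eval_expPi hr]
    refine (mem_ae_iff_prob_eq_one (s := Set.Ioi 0) measurableSet_Ioi).2 ?_
    simpa using expMeasure_Ioi (NNReal.coe_pos.2 (hr c)) 0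
  exact ae_of_ae_map (measurable_pi_apply c).aemeasurable h1

lemma ae_ne_expPi (hr : ∀ c, 0 < r c) {c c' : C} (hc : c ≠ c') : ∀ᵐ w ∂expPi r, w c ≠ w c' := by
  have := fun c => isProbabilityMeasure_expMeasure (NNReal.coe_pos.2 (hr c))
  have := isProbabilityMeasure_expPi hr
  have h1 : iIndepFun (fun (c : C) (w : C → ℝ) => w c) (expPi r) :=
    iIndepFun_pi (X := fun _ x => x) fun _ => aemeasurable_id
  have h2 := (indepFun_iff_map_prod_eq_prod_map_map (measurable_pi_apply c).aemeasurable
    (measurable_pi_apply c').aemeasurable).1 (h1.indepFun hc.symm.symm)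
  rw [map_eval_expPi hr, map_eval_expPi hr] at h2
  have hm : MeasurableSet {p : ℝ × ℝ | p.1 = p.2} := measurableSet_eq_fun measurable_fst measurable_snd
  have h3 : ((expMeasure (r c)).prod (expMeasure (r c'))) {p : ℝ × ℝ | p.1 = p.2} = 0 := by
    rw [Measure.measure_prod_null hm]
    refine ae_of_all _ fun x => ?_
    have h4 : Prod.mk x ⁻¹' {p : ℝ × ℝ | p.1 = p.2} = {x} := by
      ext y; simp [eq_comm]
    simp only [h4, Pi.zero_apply]
    exact expMeasure_singleton _ _
  rw [← h2, Measure.map_apply ((measurable_pi_apply c).prodMk (measurable_pi_apply c')) hm] at h3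
  rw [ae_iff]
  simpa using h3

lemma memLp_eval_expPi (hr : ∀ c, 0 < r c) (c : C) : MemLp (fun w : C → ℝ => w c) 2 (expPi r) := by
  have hrc := NNReal.coe_pos.2 (hr c)
  have h1 : MemLp id 2 (expMeasure (r c)) := by
    refine (memLp_two_iff_integrable_sq measurable_id.aestronglyMeasurable).2 ?_
    rw [expMeasure, gammaMeasure, integrable_withDensity_iff (f := gammaPDF 1 (r c))
      (measurable_gammaPDFReal _ _).ennreal_ofReal (ae_of_all _ fun x => ENNReal.ofReal_lt_top)]
    have h2 : IntegrableOn (fun x : ℝ => (r c : ℝ) * (x ^ (2 : ℝ) * Real.exp (-(r c) * x)))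
        (Set.Ioi 0) :=
      (integrableOn_rpow_mul_exp_neg_mul_rpow (p := 1) (s := 2) (by norm_num) one_pos hrc |>.congr_fun
        (fun x _ => by simp) measurableSet_Ioi).const_mul _
    have h3 := (integrable_indicator_iff measurableSet_Ioi).2 h2
    refine h3.congr (ae_of_all _ fun x => ?_)
    change _ = x ^ 2 * (exponentialPDF (r c) x).toReal
    by_cases hx : 0 < x
    · rw [Set.indicator_of_mem (Set.mem_Ioi.2 hx), exponentialPDF_of_nonneg hx.le,
        ENNReal.toReal_ofReal (by positivity), Real.rpow_two]
      ring_nf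
    · rw [Set.indicator_of_notMem (by simpa using hx)]
      rcases (not_lt.1 hx).lt_or_eq with h | rfl
      · simp [exponentialPDF_of_neg h]
      · simp
  rw [← map_eval_expPi hr c] at h1
  exact (memLp_map_measure_iff measurable_id.aestronglyMeasurable
    (measurable_pi_apply c).aemeasurable).1 h1

lemma integral_eval_expPi_pos (hr : ∀ c, 0 < r c) (c : C) : 0 < ∫ w, w c ∂expPi r := by
  have := isProbabilityMeasure_expPi hr
  have h0 := ae_pos_expPi hr c
  refine (integral_pos_iff_support_of_nonneg_ae (h0.mono fun w hw => hw.le)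
    ((memLp_eval_expPi hr c).integrable one_le_two)).2 ?_
  have h1 : Function.support (fun w : C → ℝ => w c) =ᵐ[expPi r] Set.univ := by
    filter_upwards [h0] with w hw
    exact eq_true hw.ne'
  rw [measure_congr h1]
  simp

end ExpPi

/-! ### Order statistics -/

section OrderStat

variable {ι : Type*} [Finite ι] {k : ℕ}

/-- The set of admissible levels is upward closed, nonempty since k ≤ card ι, bounded below since k
≥ 1, and closed as a finite union of intersections of closed half-lines; hence its infimum is
attained. -/
lemma orderStat_le_iff (hk : 1 ≤ k) (hkι : k ≤ Nat.card ι) (x : ι → ℝ) (t : ℝ) :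
    orderStat k x ≤ t ↔ k ≤ {i | x i ≤ t}.ncard := by
  set A : Set ℝ := {t | k ≤ {i | x i ≤ t}.ncard} with hA
  have hmono : ∀ s t, s ≤ t → s ∈ A → t ∈ A := fun s t hst hs =>
    le_trans hs (Set.ncard_le_ncard (fun i hi => le_trans hi hst) (Set.toFinite _))
  obtain ⟨b, hb⟩ := (Set.finite_range x).bddBelow
  obtain ⟨B, hB⟩ := (Set.finite_range x).bddAbove
  have hne : A.Nonempty := by
    refine ⟨B, ?_⟩
    have : {i | x i ≤ B} = Set.univ := Set.eq_univ_of_forall fun i => hB ⟨i, rfl⟩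
    simp only [hA, Set.mem_ofPred_eq, this, Set.ncard_univ]
    exact hkι
  have hbdd : BddBelow A := by
    refine ⟨b, fun t ht => ?_⟩
    have h1 : 0 < {i | x i ≤ t}.ncard := lt_of_lt_of_le hk ht
    obtain ⟨i, hi⟩ := Set.nonempty_of_ncard_ne_zero h1.ne'
    exact (hb ⟨i, rfl⟩).trans hi
  have hclosed : IsClosed A := by
    have : A = ⋃ s ∈ {s : Set ι | k ≤ s.ncard}, ⋂ i ∈ s, Set.Ici (x i) := by
      ext t
      simp only [hA, Set.mem_ofPred_eq, Set.mem_iUnion, Set.mem_iInter, Set.mem_Ici, exists_prop]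
      exact ⟨fun h => ⟨_, h, fun i hi => hi⟩, fun ⟨s, hs, h⟩ =>
        hs.trans (Set.ncard_le_ncard (fun i hi => h i hi) (Set.toFinite _))⟩
    rw [this]
    exact (Set.toFinite _).isClosed_biUnion fun s _ => isClosed_biInter fun i _ => isClosed_Ici
  exact ⟨fun h => hmono _ _ h (hclosed.csInf_mem hne hbdd), fun h => csInf_le hbdd h⟩

lemma orderStat_lt_iff (hk : 1 ≤ k) (hkι : k ≤ Nat.card ι) (x : ι → ℝ) (t : ℝ) :
    orderStat k x < t ↔ k ≤ {i | x i < t}.ncard := by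
  constructor
  · intro h
    refine ((orderStat_le_iff hk hkι x _).1 le_rfl).trans ?_
    exact Set.ncard_le_ncard (fun i hi => lt_of_le_of_lt hi h) (Set.toFinite _)
  · intro h
    have hne : {i | x i < t}.Nonempty :=
      Set.nonempty_of_ncard_ne_zero (lt_of_lt_of_le hk h).ne'
    obtain ⟨m, hm, hmax⟩ := Set.exists_max_image _ x (Set.toFinite _) hne
    refine lt_of_le_of_lt ((orderStat_le_iff hk hkι x (x m)).2 (h.trans ?_)) hm
    exact Set.ncard_le_ncard (fun i hi => hmax i hi) (Set.toFinite _)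

lemma exists_orderStat_eq (hk : 1 ≤ k) (hkι : k ≤ Nat.card ι) (x : ι → ℝ) :
    ∃ i, orderStat k x = x i := by
  by_contra! h
  have h1 := (orderStat_le_iff hk hkι x _).1 le_rfl
  have h2 : {i | x i ≤ orderStat k x} = {i | x i < orderStat k x} := by
    ext i
    exact ⟨fun hi => lt_of_le_of_ne hi (h i).symm, fun (hi : x i < _) => (hi.le : x i ≤ _)⟩
  rw [h2] at h1
  exact lt_irrefl _ ((orderStat_lt_iff hk hkι x _).2 h1)

lemma measurable_orderStat {α : Type*} [MeasurableSpace α] (hk : 1 ≤ k) (hkι : k ≤ Nat.card ι)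
    {x : α → ι → ℝ} (hx : ∀ i, Measurable fun a => x a i) :
    Measurable fun a => orderStat k (x a) := by
  refine measurable_of_Iic fun t => ?_
  have : (fun a => orderStat k (x a)) ⁻¹' Set.Iic t =
      ⋃ s ∈ {s : Set ι | k ≤ s.ncard}, ⋂ i ∈ s, {a | x a i ≤ t} := by
    ext a
    simp only [Set.mem_preimage, Set.mem_Iic, orderStat_le_iff hk hkι, Set.mem_ofPred_eq,
      Set.mem_iUnion, Set.mem_iInter, exists_prop]
    exact ⟨fun h => ⟨_, h, fun i hi => hi⟩, fun ⟨s, hs, h⟩ =>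
      hs.trans (Set.ncard_le_ncard (fun i hi => h i hi) (Set.toFinite _))⟩
  rw [this]
  exact MeasurableSet.biUnion (Set.toFinite _).countable fun s _ =>
    MeasurableSet.biInter (Set.toFinite _).countable fun i _ => measurableSet_le (hx i) measurable_const

lemma orderStat_nonneg (hk : 1 ≤ k) (hkι : k ≤ Nat.card ι) {x : ι → ℝ} (hx : ∀ i, 0 ≤ x i) :
    0 ≤ orderStat k x := by
  obtain ⟨i, hi⟩ := exists_orderStat_eq hk hkι x
  exact hi ▸ hx i

/-- Truncating at u does not affect which members are ≤ t when t < u, and for t ≥ u both sides are ≤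
t. -/
lemma min_orderStat_min (hk : 1 ≤ k) (hkι : k ≤ Nat.card ι) (x : ι → ℝ) (u : ℝ) :
    min (orderStat k fun i => min (x i) u) u = min (orderStat k x) u := by
  refine eq_of_forall_ge_iff fun t => ?_
  rcases le_or_gt u t with h | h
  · simp [h]
  · simp [orderStat_le_iff hk hkι, h.not_ge]

end OrderStat

/-! ### One cycle between two source updates -/

section Cycle

variable {ι C : Type*} {k : ℕ} {r : C → ℝ≥0}

/-- The smaller of the waiting time for `c` and of the `k`-th smallest waiting time of the
family `e`. -/
noncomputable def cycleMin (k : ℕ) (e : ι → C) (c : C) (w : C → ℝ) : ℝ :=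
  min (orderStat k fun i => w (e i)) (w c)

lemma cycleMin_lt_iff (e : ι → C) (c : C) (w : C → ℝ) :
    cycleMin k e c w < w c ↔ orderStat k (fun i => w (e i)) < w c := by
  simp [cycleMin]

variable [Finite ι]

/-- This is what makes the outcome of a cycle observable at its end: waiting times running past the
end of the cycle matter only through their truncation. -/
lemma cycleMin_min (hk : 1 ≤ k) (hkι : k ≤ Nat.card ι) (e : ι → C) (c : C) (w : C → ℝ) :
    cycleMin k e c (fun c' => min (w c') (w c)) = cycleMin k e c w := by
  simp only [cycleMin, min_self]
  exact min_orderStat_min hk hkι _ _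

lemma measurable_cycleMin (hk : 1 ≤ k) (hkι : k ≤ Nat.card ι) (e : ι → C) (c : C) :
    Measurable (cycleMin k e c) :=
  (measurable_orderStat hk hkι fun i => measurable_pi_apply (e i)).min (measurable_pi_apply c)

lemma cycleMin_nonneg (hk : 1 ≤ k) (hkι : k ≤ Nat.card ι) (e : ι → C) (c : C) {w : C → ℝ}
    (hw : ∀ c, 0 ≤ w c) : 0 ≤ cycleMin k e c w :=
  le_min (orderStat_nonneg hk hkι fun _ => hw _) (hw _)

lemma measurableSet_cycleMin_lt (hk : 1 ≤ k) (hkι : k ≤ Nat.card ι) (e : ι → C) (c : C) :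
    MeasurableSet {w : C → ℝ | cycleMin k e c w < w c} :=
  measurableSet_lt (measurable_cycleMin hk hkι e c) (measurable_pi_apply c)

variable [Fintype C]

lemma memLp_cycleMin (hr : ∀ c, 0 < r c) (hk : 1 ≤ k) (hkι : k ≤ Nat.card ι) (e : ι → C) (c : C) :
    MemLp (cycleMin k e c) 2 (expPi r) := by
  refine (memLp_eval_expPi hr c).mono (measurable_cycleMin hk hkι e c).aestronglyMeasurable ?_
  filter_upwards [ae_all_iff.2 (ae_pos_expPi hr)] with w hw
  rw [Real.norm_of_nonneg (cycleMin_nonneg hk hkι e c fun c => (hw c).le),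
    Real.norm_of_nonneg (hw c).le]
  exact min_le_right _ _

lemma measure_cycleMin_lt_pos (hr : ∀ c, 0 < r c) (hk : 1 ≤ k) (hkι : k ≤ Nat.card ι) {e : ι → C}
    {c : C} (hec : ∀ i, e i ≠ c) : 0 < (expPi r).real {w | cycleMin k e c w < w c} := by
  classical
  have := fun c => isProbabilityMeasure_expMeasure (NNReal.coe_pos.2 (hr c))
  have := isProbabilityMeasure_expPi hr
  refine ENNReal.toReal_pos (ne_of_gt ?_) (measure_ne_top _ _)
  -- On this box the cycle is longer than 1 and all other waiting times are at most 1, so the cycle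
  -- succeeds; each side of the box has positive mass.
  have hsub : (Set.univ.pi fun c' => if c' = c then Set.Ioi 1 else Set.Iic 1) ⊆
      {w : C → ℝ | cycleMin k e c w < w c} := by
    intro w hw
    rw [Set.mem_univ_pi] at hw
    have h1 : 1 < w c := by simpa using hw c
    have h2 : ∀ i, w (e i) ≤ 1 := fun i => by simpa [hec i] using hw (e i)
    rw [Set.mem_ofPred_eq, cycleMin_lt_iff, orderStat_lt_iff hk hkι]
    have h3 : {i | w (e i) < w c} = Set.univ := Set.eq_univ_of_forall fun i => (h2 i).trans_lt h1
    rw [h3, Set.ncard_univ]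
    exact hkι
  refine lt_of_lt_of_le ?_ (measure_mono hsub)
  rw [expPi, Measure.pi_pi]
  refine pos_iff_ne_zero.2 (Finset.prod_ne_zero_iff.2 fun c' _ => ?_)
  have hIoi := expMeasure_Ioi (NNReal.coe_pos.2 (hr c')) 1
  split_ifs
  · rw [hIoi]
    simpa using Real.exp_pos _
  · rw [← Set.compl_Ioi, prob_compl_eq_one_sub measurableSet_Ioi, hIoi]
    refine (tsub_pos_of_lt ?_).ne'
    rw [ENNReal.ofReal_lt_one]
    simpa using hr c'

/-- Independent exponentials almost surely have no ties. This reconciles the non-strict inequality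
of the theorem with the strict one that defines a successful cycle. -/
lemma measure_orderStat_le_eq (hr : ∀ c, 0 < r c) (hk : 1 ≤ k) (hkι : k ≤ Nat.card ι) {e : ι → C}
    {c : C} (hec : ∀ i, e i ≠ c) : (expPi r).real {w | orderStat k (fun i => w (e i)) ≤ w c} =
      (expPi r).real {w | cycleMin k e c w < w c} := by
  refine measureReal_congr ?_
  filter_upwards [ae_all_iff.2 fun i => ae_ne_expPi hr (hec i)] with w hw
  refine propext ((cycleMin_lt_iff e c w).trans ⟨le_of_lt, fun h => lt_of_le_of_ne h ?_⟩).symm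
  obtain ⟨i, hi⟩ := exists_orderStat_eq hk hkι fun i => w (e i)
  rw [hi]
  exact hw i

end Cycle

/-! ### Averages over the successive cycles -/

/-- The successive jump times of the counter `N`, with time `0` as the zeroth one. -/
noncomputable def jumpTime {Ω : Type*} (N : ℝ≥0 → Ω → ℕ) : ℕ → Ω → ℝ≥0
  | 0 => fun _ => 0
  | ℓ + 1 => fun ω => jumpTime N ℓ ω + gap N (jumpTime N ℓ ω) ω

open Classical in
/-- The number of steps since the last success before step `ℓ`, where step `0` counts as a
success. -/
noncomputable def staleness (s : ℕ → Prop) : ℕ → ℕ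
  | 0 => 0
  | ℓ + 1 => if s ℓ then 1 else staleness s ℓ + 1

lemma staleness_le (s : ℕ → Prop) (ℓ : ℕ) : staleness s ℓ ≤ ℓ := by
  induction ℓ with
  | zero => exact le_rfl
  | succ ℓ ih => simp only [staleness]; split_ifs <;> omega

section Family

variable {Ω C : Type*} {mΩ : MeasurableSpace Ω} {P : Measure Ω} {N : C → ℝ≥0 → Ω → ℕ}
  {r : C → ℝ≥0}

namespace IsPoissonFamily

lemma isStop_jumpTime (h : IsPoissonFamily P N r) (c : C) (ℓ : ℕ) : IsStop N (jumpTime (N c) ℓ) := by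
  induction ℓ with
  | zero =>
    intro t
    simp [jumpTime]
  | succ ℓ ih => exact h.isStop_add_gap ih c

lemma jumpTime_lt_succ (h : IsPoissonFamily P N r) (c : C) (ℓ : ℕ) (ω : Ω) :
    jumpTime (N c) ℓ ω < jumpTime (N c) (ℓ + 1) ω :=
  lt_add_of_pos_right _ (h.gap_pos c _ ω)

lemma jumpTime_mono (h : IsPoissonFamily P N r) (c : C) (ω : Ω) :
    Monotone fun ℓ => jumpTime (N c) ℓ ω :=
  monotone_nat_of_le_succ fun ℓ => (h.jumpTime_lt_succ c ℓ ω).le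

lemma sum_gaps_jumpTime (N : C → ℝ≥0 → Ω → ℕ) (c : C) (L : ℕ) (ω : Ω) :
    ∑ ℓ ∈ Finset.range L, gaps N (jumpTime (N c) ℓ) ω c = jumpTime (N c) L ω := by
  induction L with
  | zero => simp [jumpTime]
  | succ L ih => rw [Finset.sum_range_succ, ih]; simp [gaps, jumpTime]

/-- The waiting times of a cycle, truncated at its end, are known at its end. -/
lemma measurable_gaps_min (h : IsPoissonFamily P N r) (c : C) (ℓ : ℕ) :
    Measurable[stoppedPast N _ (h.isStop_jumpTime c (ℓ + 1))]
      (fun ω c' => min (gaps N (jumpTime (N c) ℓ) ω c') (gaps N (jumpTime (N c) ℓ) ω c)) := by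
  have hτ := h.isStop_jumpTime c ℓ
  have hσ := h.isStop_jumpTime c (ℓ + 1)
  let _ := stoppedPast N _ hσ
  refine measurable_pi_lambda _ fun c' => ?_
  have h1 : Measurable (jumpTime (N c) ℓ) :=
    hτ.measurable hσ fun ω => (h.jumpTime_lt_succ c ℓ ω).le
  have h2 : Measurable fun ω => min (jumpTime (N c) ℓ ω + gap (N c') (jumpTime (N c) ℓ ω) ω)
      (jumpTime (N c) (ℓ + 1) ω) :=
    ((h.isStop_add_gap hτ c').min hσ).measurable hσ fun ω => min_le_right _ _
  -- The truncated waiting time is min(τ_ℓ + gap, τ_{ℓ+1}) − τ_ℓ, a difference of stopping times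
  -- that do not exceed τ_{ℓ+1}.
  convert h2.coe_nnreal_real.sub h1.coe_nnreal_real using 2 with ω
  simp only [gaps, jumpTime, NNReal.coe_min, NNReal.coe_add, Pi.sub_apply]
  rw [← min_sub_sub_right, add_sub_cancel_left, add_sub_cancel_left]

lemma integral_comp_gaps [Fintype C] [IsProbabilityMeasure P] (h : IsPoissonFamily P N r)
    {τ : Ω → ℝ≥0} (hτ : IsStop N τ) {g : (C → ℝ) → ℝ} (hg : Measurable g) :
    ∫ ω, g (gaps N τ ω) ∂P = ∫ w, g w ∂expPi r := by
  rw [← h.map_gaps hτ, integral_map (h.measurable_gaps hτ).aemeasurable hg.aestronglyMeasurable]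

lemma indepFun_comp_gaps [Fintype C] [IsProbabilityMeasure P] (h : IsPoissonFamily P N r)
    {τ : Ω → ℝ≥0} (hτ : IsStop N τ) {g : (C → ℝ) → ℝ} (hg : Measurable g) {f : Ω → ℝ}
    (hf : Measurable[stoppedPast N τ hτ] f) : IndepFun f (fun ω => g (gaps N τ ω)) P := by
  rw [IndepFun_iff_Indep]
  refine indep_of_indep_of_le_left (indep_of_indep_of_le_right (h.indep_gaps hτ) ?_) hf.comap_le
  exact (hg.comp (comap_measurable (gaps N τ))).comap_le

lemma integral_mul_comp_gaps [Fintype C] [IsProbabilityMeasure P] (h : IsPoissonFamily P N r)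
    {τ : Ω → ℝ≥0} (hτ : IsStop N τ) {g : (C → ℝ) → ℝ} (hg : Measurable g) {f : Ω → ℝ}
    (hf : Measurable[stoppedPast N τ hτ] f) :
    ∫ ω, f ω * g (gaps N τ ω) ∂P = (∫ ω, f ω ∂P) * ∫ w, g w ∂expPi r := by
  rw [(h.indepFun_comp_gaps hτ hg hf).integral_fun_mul_eq_mul_integral
    (hf.mono (h.stoppedPast_le hτ) le_rfl).aestronglyMeasurable
    (hg.comp (h.measurable_gaps hτ)).aestronglyMeasurable, h.integral_comp_gaps hτ hg]

/-- Law of large numbers for the martingale with the increments `f ℓ * g (W ℓ)`, where `W ℓ` are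
the waiting times of the `ℓ`-th cycle, `g` is centered, and `f ℓ` is known when the cycle starts. -/
lemma ae_tendsto_average_cycles [Fintype C] [IsProbabilityMeasure P] (h : IsPoissonFamily P N r)
    (c : C) {g : (C → ℝ) → ℝ} (hg : Measurable g) (hg2 : MemLp g 2 (expPi r))
    (hg0 : ∫ w, g w ∂expPi r = 0) (hgmin : ∀ w, g (fun c' => min (w c') (w c)) = g w)
    {f : ℕ → Ω → ℝ} (hf : ∀ ℓ, Measurable[stoppedPast N _ (h.isStop_jumpTime c ℓ)] (f ℓ))
    (hf2 : ∀ ℓ, MemLp (f ℓ) 2 P) {K : ℝ} (hK : ∀ ℓ, ∫ ω, f ℓ ω ^ 2 ∂P ≤ K) :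
    ∀ᵐ ω ∂P, Tendsto (fun L : ℕ =>
      (∑ ℓ ∈ Finset.range L, f ℓ ω * g (gaps N (jumpTime (N c) ℓ) ω)) / L) atTop (𝓝 0) := by
  have hτ := h.isStop_jumpTime c
  have hgsq : Measurable fun w => g w ^ 2 := hg.pow_const 2
  have hfsq : ∀ ℓ, Measurable[stoppedPast N _ (hτ ℓ)] fun ω => f ℓ ω ^ 2 := fun ℓ =>
    (hf ℓ).pow_const 2
  have hfm : ∀ ℓ, Measurable (f ℓ) := fun ℓ => (hf ℓ).mono (h.stoppedPast_le (hτ ℓ)) le_rfl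
  have hgm : ∀ ℓ, Measurable fun ω => g (gaps N (jumpTime (N c) ℓ) ω) := fun ℓ =>
    hg.comp (h.measurable_gaps (hτ ℓ))
  have hgnext : ∀ ℓ, Measurable[stoppedPast N _ (hτ (ℓ + 1))]
      fun ω => g (gaps N (jumpTime (N c) ℓ) ω) := fun ℓ => by
    have := hg.comp (h.measurable_gaps_min c ℓ)
    simpa only [Function.comp_def, hgmin] using this
  refine ae_tendsto_average_of_orthogonal (K := K * ∫ w, g w ^ 2 ∂expPi r) (fun ℓ => ?_)
    (fun ℓ => ?_) (fun m n hmn => ?_)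
  · refine (memLp_two_iff_integrable_sq ((hfm ℓ).mul (hgm ℓ)).aestronglyMeasurable).2 ?_
    have h1 : Integrable (fun ω => g (gaps N (jumpTime (N c) ℓ) ω) ^ 2) P := by
      have h2 := hg2.integrable_sq
      rw [← h.map_gaps (hτ ℓ)] at h2
      exact h2.comp_measurable (h.measurable_gaps (hτ ℓ))
    refine Integrable.congr (f := fun ω => f ℓ ω ^ 2 * g (gaps N (jumpTime (N c) ℓ) ω) ^ 2) ?_
      (ae_of_all _ fun ω => (mul_pow _ _ 2).symm)
    exact (h.indepFun_comp_gaps (hτ ℓ) hgsq (hfsq ℓ)).integrable_mul (hf2 ℓ).integrable_sq h1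
  · simp only [mul_pow]
    rw [h.integral_mul_comp_gaps (hτ ℓ) hgsq (hfsq ℓ)]
    exact mul_le_mul_of_nonneg_right (hK ℓ) (integral_nonneg fun w => sq_nonneg _)
  -- For m < n, every factor except g(W_n) is known at τ_n, and g is centered.
  · simp only [← mul_assoc]
    rw [h.integral_mul_comp_gaps (hτ n) hg, hg0, mul_zero]
    have hle : stoppedPast N _ (hτ (m + 1)) ≤ stoppedPast N _ (hτ n) :=
      stoppedPast_mono _ _ fun ω => h.jumpTime_mono c ω hmn
    have hle' : stoppedPast N _ (hτ m) ≤ stoppedPast N _ (hτ n) :=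
      stoppedPast_mono _ _ fun ω => h.jumpTime_mono c ω hmn.le
    let _ := stoppedPast N _ (hτ n)
    exact (((hf m).mono hle' le_rfl).mul ((hgnext m).mono hle le_rfl)).mul (hf n)

/-- The L-th jump time is the sum of L cycle lengths, so this is the preceding law with f = 1 and g
the centered cycle length. -/
lemma ae_tendsto_jumpTime_div [Fintype C] [IsProbabilityMeasure P] (h : IsPoissonFamily P N r)
    (c : C) : ∀ᵐ ω ∂P, Tendsto (fun L : ℕ => (jumpTime (N c) L ω : ℝ) / L) atTop
      (𝓝 (∫ w, w c ∂expPi r)) := by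
  have := isProbabilityMeasure_expPi h.rate_pos
  have hc := memLp_eval_expPi h.rate_pos c
  have h1 := h.ae_tendsto_average_cycles c (g := fun w => w c - ∫ w, w c ∂expPi r)
    ((measurable_pi_apply c).sub_const _) (hc.sub (memLp_const _))
    (by rw [integral_sub (hc.integrable one_le_two) (integrable_const _)]; simp) (by simp)
    (f := fun _ _ => 1) (fun _ => measurable_const) (fun _ => memLp_const _) (K := 1) (by simp)
  filter_upwards [h1] with ω hω
  have h2 := hω.add_const (∫ w, w c ∂expPi r)
  rw [zero_add] at h2
  refine h2.congr' ?_
  filter_upwards [eventually_gt_atTop 0] with L hL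
  have hL' : (L : ℝ) ≠ 0 := by positivity
  simp only [one_mul, Finset.sum_sub_distrib, sum_gaps_jumpTime, Finset.sum_const,
    Finset.card_range, nsmul_eq_mul]
  field_simp
  ring

section Staleness

variable {ι : Type*} [Finite ι] {k : ℕ} {e : ι → C} {c : C}

lemma measurable_staleness (h : IsPoissonFamily P N r) (hk : 1 ≤ k) (hkι : k ≤ Nat.card ι) (ℓ : ℕ) :
    Measurable[stoppedPast N _ (h.isStop_jumpTime c ℓ)] fun ω =>
      staleness (fun m => cycleMin k e c (gaps N (jumpTime (N c) m) ω) <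
        gaps N (jumpTime (N c) m) ω c) ℓ := by
  have hτ := h.isStop_jumpTime c
  induction ℓ with
  | zero => exact @measurable_const _ _ _ (stoppedPast N _ (hτ 0)) _
  | succ ℓ ih =>
    have hle : stoppedPast N _ (hτ ℓ) ≤ stoppedPast N _ (hτ (ℓ + 1)) :=
      stoppedPast_mono _ _ fun ω => (h.jumpTime_lt_succ c ℓ ω).le
    have h1 := ih.mono hle le_rfl
    have h2 := h.measurable_gaps_min c ℓ (measurableSet_cycleMin_lt hk hkι e c)
    simp only [Set.preimage, Set.mem_ofPred_eq, min_self, cycleMin_min hk hkι] at h2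
    let _ := stoppedPast N _ (hτ (ℓ + 1))
    exact Measurable.ite h2 measurable_const (h1.add_const 1)

/-- The crude bound B_ℓ ≤ ℓ is enough for integrability at each ℓ; a bound uniform in ℓ needs the
recursion that follows. -/
lemma memLp_staleness [IsProbabilityMeasure P] (h : IsPoissonFamily P N r) (hk : 1 ≤ k)
    (hkι : k ≤ Nat.card ι) (ℓ : ℕ) :
    MemLp (fun ω => (staleness (fun m => cycleMin k e c (gaps N (jumpTime (N c) m) ω) <
        gaps N (jumpTime (N c) m) ω c) ℓ : ℝ)) 2 P := by
  refine MemLp.of_bound (C := ℓ) ?_ (ae_of_all _ fun ω => ?_)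
  · exact (measurable_from_top.comp ((h.measurable_staleness hk hkι ℓ).mono
      (h.stoppedPast_le _) le_rfl)).aestronglyMeasurable
  · rw [Real.norm_natCast]
    exact_mod_cast staleness_le _ _

variable [Fintype C] [IsProbabilityMeasure P]

/-- B_{ℓ+1} = 1 + B_ℓ F_ℓ, where the failure indicator F_ℓ is independent of B_ℓ and has mean 1 − p.
The first two moments thus obey affine recursions with factor 1 − p < 1 and stay below their fixed
points. -/
lemma integral_staleness_sq_le (h : IsPoissonFamily P N r) (hk : 1 ≤ k) (hkι : k ≤ Nat.card ι)
    (hec : ∀ i, e i ≠ c) : ∃ K, ∀ ℓ,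
    ∫ ω, (staleness (fun m => cycleMin k e c (gaps N (jumpTime (N c) m) ω) <
        gaps N (jumpTime (N c) m) ω c) ℓ : ℝ) ^ 2 ∂P ≤ K := by
  classical
  have := isProbabilityMeasure_expPi h.rate_pos
  have hτ := h.isStop_jumpTime c
  set B : ℕ → Ω → ℝ := fun ℓ ω => (staleness (fun m => cycleMin k e c
    (gaps N (jumpTime (N c) m) ω) < gaps N (jumpTime (N c) m) ω c) ℓ : ℝ) with hB
  set S := {w : C → ℝ | cycleMin k e c w < w c} with hS
  have hSm : MeasurableSet S := measurableSet_cycleMin_lt hk hkι e c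
  set p := (expPi r).real S with hp
  have hp0 : 0 < p := measure_cycleMin_lt_pos h.rate_pos hk hkι hec
  have hp1 : p ≤ 1 := measureReal_le_one
  set F : (C → ℝ) → ℝ := Sᶜ.indicator 1 with hF
  have hFm : Measurable F := measurable_one.indicator hSm.compl
  have hFint : ∫ w, F w ∂expPi r = 1 - p := by
    rw [hF, integral_indicator_one hSm.compl, probReal_compl_eq_one_sub hSm]
  have hBm : ∀ ℓ, Measurable[stoppedPast N _ (hτ ℓ)] (B ℓ) := fun ℓ =>
    measurable_from_top.comp (h.measurable_staleness hk hkι ℓ)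
  have hB2 : ∀ ℓ, MemLp (B ℓ) 2 P := fun ℓ => h.memLp_staleness hk hkι ℓ
  have hFW : ∀ ℓ, Measurable fun ω => F (gaps N (jumpTime (N c) ℓ) ω) := fun ℓ =>
    hFm.comp (h.measurable_gaps (hτ ℓ))
  have hFle : ∀ w, ‖F w‖ ≤ 1 := fun w => by
    by_cases hw : w ∈ S <;> simp [hF, hw]
  have hrec : ∀ ℓ ω, B (ℓ + 1) ω = 1 + B ℓ ω * F (gaps N (jumpTime (N c) ℓ) ω) := by
    intro ℓ ω
    by_cases hw : gaps N (jumpTime (N c) ℓ) ω ∈ S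
    · have hw' := hw
      simp only [hS, Set.mem_ofPred_eq] at hw'
      simp [hB, staleness, hF, hw, hw']
    · have hw' := hw
      simp only [hS, Set.mem_ofPred_eq] at hw'
      simp [hB, staleness, hF, hw, hw', add_comm]
  have hrec2 : ∀ ℓ ω, B (ℓ + 1) ω ^ 2 = 1 + (2 * B ℓ ω + B ℓ ω ^ 2) *
      F (gaps N (jumpTime (N c) ℓ) ω) := by
    intro ℓ ω
    rw [hrec]
    by_cases hw : gaps N (jumpTime (N c) ℓ) ω ∈ S <;> simp [hF, hw]
    ring
  have hi1 : ∀ ℓ, Integrable (B ℓ) P := fun ℓ => (hB2 ℓ).integrable one_le_two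
  have hi2 : ∀ ℓ, Integrable (fun ω => 2 * B ℓ ω + B ℓ ω ^ 2) P := fun ℓ =>
    ((hi1 ℓ).const_mul 2).add (hB2 ℓ).integrable_sq
  have hE1 : ∀ ℓ, ∫ ω, B (ℓ + 1) ω ∂P = 1 + (∫ ω, B ℓ ω ∂P) * (1 - p) := by
    intro ℓ
    simp only [hrec]
    rw [integral_add (integrable_const _) ((hi1 ℓ).mul_bdd (c := 1) (hFW ℓ).aestronglyMeasurable
      (ae_of_all _ fun ω => hFle _)), h.integral_mul_comp_gaps (hτ ℓ) hFm (hBm ℓ), hFint]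
    simp
  have hE2 : ∀ ℓ, ∫ ω, B (ℓ + 1) ω ^ 2 ∂P =
      1 + (2 * (∫ ω, B ℓ ω ∂P) + ∫ ω, B ℓ ω ^ 2 ∂P) * (1 - p) := by
    intro ℓ
    simp only [hrec2]
    have hm : Measurable[stoppedPast N _ (hτ ℓ)] fun ω => 2 * B ℓ ω + B ℓ ω ^ 2 :=
      ((hBm ℓ).const_mul 2).add ((hBm ℓ).pow_const 2)
    rw [integral_add (integrable_const _) ((hi2 ℓ).mul_bdd (c := 1) (hFW ℓ).aestronglyMeasurable
      (ae_of_all _ fun ω => hFle _)), h.integral_mul_comp_gaps (hτ ℓ) hFm hm, hFint,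
      integral_add ((hi1 ℓ).const_mul 2) (hB2 ℓ).integrable_sq, integral_const_mul]
    simp
  have hb1 : ∀ ℓ, ∫ ω, B ℓ ω ∂P ≤ 1 / p := by
    intro ℓ
    induction ℓ with
    | zero => simp [hB, staleness, hp0.le]
    | succ ℓ ih =>
      rw [hE1]
      calc _ ≤ 1 + 1 / p * (1 - p) := by gcongr
        _ = 1 / p := by field_simp; ring
  -- The solution x of x = 1 + (2/p + x)(1 − p), the second-moment recursion with the first moment
  -- replaced by its bound 1/p.
  refine ⟨(1 + 2 * (1 / p) * (1 - p)) / p, fun ℓ => ?_⟩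
  change ∫ ω, B ℓ ω ^ 2 ∂P ≤ _
  have hq : 0 ≤ 1 - p := by linarith
  induction ℓ with
  | zero => simp only [hB, staleness]; simp; positivity
  | succ ℓ ih =>
    rw [hE2]
    calc _ ≤ 1 + (2 * (1 / p) + (1 + 2 * (1 / p) * (1 - p)) / p) * (1 - p) := by
          gcongr; exact hb1 ℓ
      _ = _ := by field_simp; ring

/-- The average over the cycles of the staleness times the part of the cycle before the
`k`-th waiting time. -/
theorem ae_tendsto_average_staleness (h : IsPoissonFamily P N r) (hk : 1 ≤ k)
    (hkι : k ≤ Nat.card ι) (hec : ∀ i, e i ≠ c) : ∀ᵐ ω ∂P, Tendsto (fun L : ℕ =>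
      (∑ ℓ ∈ Finset.range L, (staleness (fun m => cycleMin k e c (gaps N (jumpTime (N c) m) ω) <
        gaps N (jumpTime (N c) m) ω c) ℓ : ℝ) * cycleMin k e c (gaps N (jumpTime (N c) ℓ) ω)) / L)
      atTop (𝓝 ((∫ w, cycleMin k e c w ∂expPi r) / (expPi r).real {w | cycleMin k e c w < w c})) := by
  classical
  have := isProbabilityMeasure_expPi h.rate_pos
  have hτ := h.isStop_jumpTime c
  obtain ⟨K, hK⟩ := h.integral_staleness_sq_le hk hkι hec
  set B : ℕ → Ω → ℝ := fun ℓ ω => (staleness (fun m => cycleMin k e c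
    (gaps N (jumpTime (N c) m) ω) < gaps N (jumpTime (N c) m) ω c) ℓ : ℝ) with hB
  set S := {w : C → ℝ | cycleMin k e c w < w c} with hS
  have hSm : MeasurableSet S := measurableSet_cycleMin_lt hk hkι e c
  set p := (expPi r).real S with hp
  have hp0 : 0 < p := measure_cycleMin_lt_pos h.rate_pos hk hkι hec
  set m := ∫ w, cycleMin k e c w ∂expPi r with hm
  have hB2 : ∀ ℓ, MemLp (B ℓ) 2 P := fun ℓ => h.memLp_staleness hk hkι ℓ
  have hBm : ∀ ℓ, Measurable[stoppedPast N _ (hτ ℓ)] (B ℓ) := fun ℓ =>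
    measurable_from_top.comp (h.measurable_staleness hk hkι ℓ)
  have hMm := measurable_cycleMin (C := C) hk hkι e c
  have hM2 := memLp_cycleMin h.rate_pos hk hkι e c
  set Y : (C → ℝ) → ℝ := S.indicator 1 with hY
  have hYm : Measurable Y := measurable_one.indicator hSm
  have hY2 : MemLp Y 2 (expPi r) := (memLp_const 1).indicator hSm
  -- The combination m Y − p M is centered because E Y = p and E M = m.
  have hmart := h.ae_tendsto_average_cycles c (g := fun w => m * Y w - p * cycleMin k e c w)
    ((hYm.const_mul _).sub (hMm.const_mul _)) ((hY2.const_mul _).sub (hM2.const_mul _))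
    (by
      rw [integral_sub ((hY2.integrable one_le_two).const_mul _)
        ((hM2.integrable one_le_two).const_mul _), integral_const_mul, integral_const_mul, hY,
        integral_indicator_one hSm]
      ring)
    (fun w => by
      have h1 : (fun c' => min (w c') (w c)) ∈ S ↔ w ∈ S := by
        simp only [hS, Set.mem_ofPred_eq, cycleMin_min hk hkι, min_self]
      simp only [hY, Set.indicator_apply, h1, cycleMin_min hk hkι, Pi.one_apply])
    hBm hB2 hK
  have hBlim : ∀ᵐ ω ∂P, Tendsto (fun n : ℕ => B (n + 1) ω / ((n : ℝ) + 1)) atTop (𝓝 0) := by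
    refine ae_tendsto_zero_of_integral_sq_le (K := K) (fun n => ?_) fun n => ?_
    · simp only [div_eq_mul_inv]
      exact (hB2 _).mul_const _
    · simp only [div_pow]
      rw [integral_div]
      gcongr
      exact hK _
  filter_upwards [hmart, hBlim] with ω h1 h2
  have h2' : Tendsto (fun n : ℕ => B n ω / n) atTop (𝓝 0) := by
    refine (tendsto_add_atTop_iff_nat 1).1 ?_
    simpa using h2
  -- Telescoping: a success at step L resets the staleness from B_L to 1, a failure raises it by 1,
  -- so B_L Y_L = 1 + B_L − B_{L+1} in both cases.
  have hsum : ∀ L, ∑ ℓ ∈ Finset.range L, B ℓ ω * Y (gaps N (jumpTime (N c) ℓ) ω) = L - B L ω := by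
    intro L
    induction L with
    | zero => simp [hB, staleness]
    | succ L ih =>
      rw [Finset.sum_range_succ, ih]
      by_cases hw : gaps N (jumpTime (N c) L) ω ∈ S
      · have hw' := hw
        simp only [hS, Set.mem_ofPred_eq] at hw'
        simp [hB, staleness, hY, hw, hw']
      · have hw' := hw
        simp only [hS, Set.mem_ofPred_eq] at hw'
        simp [hB, staleness, hY, hw, hw']
  have h3 : Tendsto (fun L : ℕ => (m * (1 - B L ω / L) - (∑ ℓ ∈ Finset.range L, B ℓ ω *
      (m * Y (gaps N (jumpTime (N c) ℓ) ω) - p * cycleMin k e c (gaps N (jumpTime (N c) ℓ) ω))) / L)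
        / p) atTop (𝓝 (m / p)) := by
    have := (((h2'.const_sub 1).const_mul m).sub h1).div_const p
    simpa using this
  refine h3.congr' ?_
  filter_upwards [eventually_gt_atTop 0] with L hL
  have hL' : (L : ℝ) ≠ 0 := by positivity
  have h4 : ∑ ℓ ∈ Finset.range L, B ℓ ω * (m * Y (gaps N (jumpTime (N c) ℓ) ω) -
      p * cycleMin k e c (gaps N (jumpTime (N c) ℓ) ω)) = m * (L - B L ω) -
      p * ∑ ℓ ∈ Finset.range L, B ℓ ω * cycleMin k e c (gaps N (jumpTime (N c) ℓ) ω) := by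
    rw [← hsum, Finset.mul_sum, Finset.mul_sum, ← Finset.sum_sub_distrib]
    exact Finset.sum_congr rfl fun ℓ _ => by ring
  rw [h4]
  field_simp
  ring

end Staleness

end IsPoissonFamily

end Family

/-! ### Simple jumps, absence of ties, and interarrival times -/

/-- The probability is 1 − e^{−x}(1 + x), and e^{−x} ≥ 1 − x. -/
lemma poissonMeasure_two_le (x : ℝ≥0) :
    poissonMeasure x {n | 2 ≤ n} ≤ ENNReal.ofReal ((x : ℝ) ^ 2) := by
  have h1 : {n : ℕ | 2 ≤ n} = ({0, 1} : Set ℕ)ᶜ := by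
    ext n; simp only [Set.mem_ofPred_eq, Set.mem_compl_iff, Set.mem_insert_iff,
      Set.mem_singleton_iff]; omega
  have h2 : (poissonMeasure x).real {n | 2 ≤ n} ≤ (x : ℝ) ^ 2 := by
    rw [h1, probReal_compl_eq_one_sub (by measurability), Set.insert_eq,
      measureReal_union (by simp) (measurableSet_singleton _), poissonMeasure_real_singleton,
      poissonMeasure_real_singleton]
    have h3 := Real.one_sub_le_exp_neg (x : ℝ)
    have h4 : (0 : ℝ) ≤ x := x.2
    simp only [pow_zero, Nat.factorial, pow_one, Nat.cast_one, mul_one, div_one]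
    norm_num
    nlinarith
  rw [← ofReal_measureReal]
  exact ENNReal.ofReal_le_ofReal h2

section Family

variable {Ω C : Type*} {mΩ : MeasurableSpace Ω} {P : Measure Ω} {N : C → ℝ≥0 → Ω → ℕ}
  {r : C → ℝ≥0}

namespace IsPoissonFamily

lemma measure_two_jumps_le (h : IsPoissonFamily P N r) (c : C) (t u : ℝ≥0) :
    P {ω | N c t ω + 2 ≤ N c (t + u) ω} ≤ ENNReal.ofReal (((r c * u : ℝ≥0) : ℝ) ^ 2) := by
  have hm : Measurable fun ω => N c (t + u) ω - N c t ω :=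
    (h.measurable c _).sub (h.measurable c _)
  have h1 := (h.law c t (t + u) le_self_add).map_eq
  rw [add_tsub_cancel_left] at h1
  refine le_trans (le_of_eq ?_) (poissonMeasure_two_le (r c * u))
  rw [← h1, Measure.map_apply hm (by measurability)]
  congr 1
  ext ω
  simp only [Set.mem_ofPred_eq, Set.mem_preimage]
  omega

/-- A jump of size at least 2 in (0, T] forces an increment of at least 2 over one of T(q+1) cells
of length 1/(q+1). The union bound is of order 1/q. -/
lemma measure_double_jump (h : IsPoissonFamily P N r) (c : C) (T : ℕ) :
    P {ω | ∃ s : ℝ≥0, 0 < s ∧ s ≤ T ∧ ∀ s' < s, N c s' ω + 2 ≤ N c s ω} = 0 := by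
  have hbound : ∀ q : ℕ, P {ω | ∃ s : ℝ≥0, 0 < s ∧ s ≤ T ∧ ∀ s' < s, N c s' ω + 2 ≤ N c s ω} ≤
      ENNReal.ofReal (T * (r c : ℝ) ^ 2 * (1 / ((q : ℝ) + 1))) := by
    intro q
    have hq : (0 : ℝ≥0) < q + 1 := by positivity
    have hsub : {ω | ∃ s : ℝ≥0, 0 < s ∧ s ≤ T ∧ ∀ s' < s, N c s' ω + 2 ≤ N c s ω} ⊆
        ⋃ i ∈ Finset.range (T * (q + 1)),
          {ω | N c (i / (q + 1 : ℝ≥0)) ω + 2 ≤ N c (i / (q + 1 : ℝ≥0) + 1 / (q + 1 : ℝ≥0)) ω} := by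
      rintro ω ⟨s, hs0, hsT, hs⟩
      have hpos : 0 < ⌈(q + 1 : ℝ≥0) * s⌉₊ := Nat.ceil_pos.2 (by positivity)
      obtain ⟨i, hi⟩ := Nat.exists_eq_succ_of_ne_zero hpos.ne'
      have h1 : (i : ℝ≥0) < (q + 1 : ℝ≥0) * s := Nat.lt_ceil.1 (by omega)
      have h2 : (q + 1 : ℝ≥0) * s ≤ (i + 1 : ℕ) := Nat.ceil_le.1 hi.le
      refine Set.mem_biUnion (x := i) ?_ ?_
      · have h3 : ⌈(q + 1 : ℝ≥0) * s⌉₊ ≤ T * (q + 1) := Nat.ceil_le.2 (by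
          push_cast; rw [mul_comm]; gcongr)
        simp only [Finset.coe_range, Set.mem_Iio]
        omega
      · refine (hs _ ((div_lt_iff₀ hq).2 (by rwa [mul_comm]))).trans (h.monotone c ω ?_)
        rw [← add_div, le_div_iff₀ hq, mul_comm]
        exact_mod_cast h2
    refine (measure_mono hsub).trans ((measure_biUnion_finset_le _ _).trans ?_)
    refine (Finset.sum_le_sum fun i _ => h.measure_two_jumps_le c _ _).trans ?_
    rw [Finset.sum_const, Finset.card_range, nsmul_eq_mul, ← ENNReal.ofReal_natCast,
      ← ENNReal.ofReal_mul (by positivity)]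
    refine ENNReal.ofReal_le_ofReal (le_of_eq ?_)
    push_cast
    field_simp
  have hlim : Tendsto (fun q : ℕ => ENNReal.ofReal (T * (r c : ℝ) ^ 2 * (1 / ((q : ℝ) + 1)))) atTop
      (𝓝 0) := by
    have := (tendsto_one_div_add_atTop_nhds_zero_nat (𝕜 := ℝ)).const_mul (T * (r c : ℝ) ^ 2)
    simpa using ENNReal.tendsto_ofReal this
  exact le_antisymm (ge_of_tendsto' hlim hbound) zero_le

/-- Almost surely all jumps have size one. -/
lemma ae_apply_arrivalTime (h : IsPoissonFamily P N r) (c : C) :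
    ∀ᵐ ω ∂P, ∀ a, N c (arrivalTime (N c) a ω) ω = a := by
  have h1 : ∀ᵐ ω ∂P, ∀ T : ℕ, ¬ ∃ s : ℝ≥0, 0 < s ∧ s ≤ (T : ℝ≥0) ∧
      ∀ s' < s, N c s' ω + 2 ≤ N c s ω := by
    refine ae_all_iff.2 fun T => ?_
    rw [ae_iff]
    simpa only [not_not] using h.measure_double_jump c T
  filter_upwards [h1] with ω hω a
  set s := arrivalTime (N c) a ω with hs
  have h2 : a ≤ N c s ω := (h.arrivalTime_le_iff c a ω s).1 le_rfl
  refine le_antisymm ?_ h2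
  by_contra hlt
  obtain ⟨T, hT⟩ := exists_nat_ge s
  refine hω T ⟨s, ?_, hT, fun s' hs' => ?_⟩
  · rw [pos_iff_ne_zero]
    intro h0
    rw [h0, h.zero] at hlt
    omega
  · rw [← not_le, h.arrivalTime_le_iff] at hs'
    omega

lemma add_gap_eq_arrivalTime (h : IsPoissonFamily P N r) (c : C) {ω : Ω} {t : ℝ≥0} {a : ℕ}
    (ha : N c t ω = a) : t + gap (N c) t ω = arrivalTime (N c) (a + 1) ω := by
  refine eq_of_forall_ge_iff fun s => ?_
  rw [h.arrivalTime_le_iff]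
  rcases lt_or_ge s t with hst | hst
  · have h1 := h.monotone c ω hst.le
    simp only at h1
    refine iff_of_false (fun h2 => ?_) (by omega)
    exact absurd (le_self_add.trans h2) hst.not_ge
  · obtain ⟨u, rfl⟩ := exists_add_of_le hst
    rw [add_le_add_iff_left, h.gap_le_iff, ha, Nat.succ_le_iff]

lemma arrivalTime_zero (h : IsPoissonFamily P N r) (c : C) (ω : Ω) :
    arrivalTime (N c) 0 ω = 0 :=
  le_antisymm ((h.arrivalTime_le_iff c 0 ω 0).2 (Nat.zero_le _)) zero_le

/-- Arrival times count points with multiplicity while jump times are distinct; they agree on paths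
with simple jumps. -/
lemma arrivalTime_eq_jumpTime (h : IsPoissonFamily P N r) (c : C) {ω : Ω}
    (hω : ∀ a, N c (arrivalTime (N c) a ω) ω = a) (a : ℕ) :
    arrivalTime (N c) a ω = jumpTime (N c) a ω := by
  induction a with
  | zero => rw [h.arrivalTime_zero]; rfl
  | succ a ih =>
    rw [← h.add_gap_eq_arrivalTime c (hω a), ih]
    rfl

lemma interarrivalTime_eq_gaps (h : IsPoissonFamily P N r) (c : C) {ω : Ω}
    (hω : ∀ a, N c (arrivalTime (N c) a ω) ω = a) (a : ℕ) :
    interarrivalTime (N c) a ω = gaps N (arrivalTime (N c) a) ω c := by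
  rw [interarrivalTime, ← h.add_gap_eq_arrivalTime c (hω a)]
  simp [gaps]

lemma measurable_interarrivalTime (h : IsPoissonFamily P N r) (c : C) (a : ℕ) :
    Measurable (interarrivalTime (N c) a) :=
  (h.measurable_of_isStop (h.isStop_arrivalTime c (a + 1))).coe_nnreal_real.sub
    (h.measurable_of_isStop (h.isStop_arrivalTime c a)).coe_nnreal_real

variable [Fintype C] [IsProbabilityMeasure P]

/-- Almost surely different counters never jump at the same time. -/
lemma ae_arrivalTime_ne (h : IsPoissonFamily P N r) {c c' : C} (hc : c ≠ c') :
    ∀ᵐ ω ∂P, ∀ a b, arrivalTime (N c) (a + 1) ω ≠ arrivalTime (N c') (b + 1) ω := by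
  -- At the later of the a-th and b-th arrivals, the two next waiting times are independent
  -- exponentials, hence distinct. A common (a+1)-th and (b+1)-th arrival would make them equal
  -- there.
  have h1 : ∀ᵐ ω ∂P, ∀ a b, gaps N (fun ω => max (arrivalTime (N c) a ω)
      (arrivalTime (N c') b ω)) ω c ≠ gaps N (fun ω => max (arrivalTime (N c) a ω)
      (arrivalTime (N c') b ω)) ω c' := by
    refine ae_all_iff.2 fun a => ae_all_iff.2 fun b => ?_
    have hτ := (h.isStop_arrivalTime c a).max (h.isStop_arrivalTime c' b)
    have h2 := ae_ne_expPi h.rate_pos hc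
    rw [← h.map_gaps hτ] at h2
    exact ae_of_ae_map (h.measurable_gaps hτ).aemeasurable h2
  filter_upwards [h1, h.ae_apply_arrivalTime c, h.ae_apply_arrivalTime c'] with ω h1 h2 h3 a b heq
  have hlt : ∀ d, (∀ a, N d (arrivalTime (N d) a ω) ω = a) → ∀ a,
      arrivalTime (N d) a ω < arrivalTime (N d) (a + 1) ω := fun d hd a => by
    rw [← not_le, h.arrivalTime_le_iff, hd]
    omega
  set ρ := max (arrivalTime (N c) a ω) (arrivalTime (N c') b ω) with hρ
  have hρlt : ρ < arrivalTime (N c) (a + 1) ω := max_lt (hlt c h2 a) (heq ▸ hlt c' h3 b)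
  have hN : N c ρ ω = a := by
    have h4 := (h.arrivalTime_le_iff c a ω ρ).1 (le_max_left _ _)
    rw [← not_le, h.arrivalTime_le_iff] at hρlt
    omega
  have hN' : N c' ρ ω = b := by
    have h4 := (h.arrivalTime_le_iff c' b ω ρ).1 (le_max_right _ _)
    rw [heq, ← not_le, h.arrivalTime_le_iff] at hρlt
    omega
  refine h1 a b ?_
  have h5 := (h.add_gap_eq_arrivalTime c hN).trans (heq.trans (h.add_gap_eq_arrivalTime c' hN').symm)
  exact congrArg NNReal.toReal (add_left_cancel h5)

/-- The indices differ between counters, so no single stopping time serves. Joint independence comes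
from that of the counters, and each marginal from the strong Markov property at the counter's own
arrival. -/
lemma map_interarrivalTime (h : IsPoissonFamily P N r) (a : C → ℕ) :
    P.map (fun ω c => interarrivalTime (N c) (a c) ω) = expPi r := by
  have hpath : ∀ c s, Measurable[MeasurableSpace.comap (fun ω t => N c t ω) inferInstance]
      (N c s) := fun c s => by
    have : N c s = (fun x : ℝ≥0 → ℕ => x s) ∘ (fun ω t => N c t ω) := rfl
    rw [this]
    exact (measurable_pi_apply _).comp (comap_measurable _)
  have harr : ∀ c b, Measurable[MeasurableSpace.comap (fun ω t => N c t ω) inferInstance]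
      (arrivalTime (N c) b) := fun c b => by
    have hc := hpath c
    let _ := MeasurableSpace.comap (fun ω (t : ℝ≥0) => N c t ω) inferInstance
    refine measurable_of_Iic fun t => ?_
    have : arrivalTime (N c) b ⁻¹' Set.Iic t = N c t ⁻¹' Set.Ici b := by
      ext ω; simp [h.arrivalTime_le_iff]
    rw [this]
    exact hc t measurableSet_Ici
  have hV : ∀ c, Measurable[MeasurableSpace.comap (fun ω t => N c t ω) inferInstance]
      (interarrivalTime (N c) (a c)) := fun c => by
    have h1 := harr c (a c)
    have h2 := harr c (a c + 1)
    let _ := MeasurableSpace.comap (fun ω (t : ℝ≥0) => N c t ω) inferInstance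
    exact h2.coe_nnreal_real.sub h1.coe_nnreal_real
  have hVm : ∀ c, Measurable (interarrivalTime (N c) (a c)) := fun c =>
    (hV c).mono (comap_pi_le fun t => h.measurable c t) le_rfl
  have hind : iIndepFun (fun c => interarrivalTime (N c) (a c)) P := by
    rw [iIndepFun_iff_measure_inter_preimage_eq_mul]
    intro S sets hsets
    exact ((iIndepFun_iff_iIndep _ _ _).1 h.indep).meas_biInter fun c hc => hV c (hsets c hc)
  rw [(iIndepFun_iff_map_fun_eq_pi_map fun c => (hVm c).aemeasurable).1 hind, expPi]
  congr 1
  funext c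
  rw [← map_eval_expPi h.rate_pos c, ← h.map_gaps (h.isStop_arrivalTime c (a c)),
    Measure.map_map (measurable_pi_apply c) (h.measurable_gaps (h.isStop_arrivalTime c (a c)))]
  refine Measure.map_congr ?_
  filter_upwards [h.ae_apply_arrivalTime c] with ω hω
  exact h.interarrivalTime_eq_gaps c hω _

end IsPoissonFamily

end Family

/-! ### From cycle averages to time averages -/

section TimeAverage

lemma intervalIntegral_step {f : ℝ → ℝ} {a b d B : ℝ} (hab : a ≤ b) (hbd : b ≤ d)
    (h1 : ∀ x, a < x → x < b → f x = B) (h2 : ∀ x, b < x → x < d → f x = 0) :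
    IntervalIntegrable f volume a d ∧ ∫ x in a..d, f x = B * (b - a) := by
  have e1 : Set.EqOn f (fun _ => B) (Set.uIoo a b) := fun x hx => by
    rw [Set.uIoo_of_le hab] at hx; exact h1 x hx.1 hx.2
  have e2 : Set.EqOn f (fun _ => 0) (Set.uIoo b d) := fun x hx => by
    rw [Set.uIoo_of_le hbd] at hx; exact h2 x hx.1 hx.2
  have i1 : IntervalIntegrable f volume a b := intervalIntegrable_const.congr_uIoo e1.symm
  have i2 : IntervalIntegrable f volume b d := intervalIntegrable_const.congr_uIoo e2.symm
  refine ⟨i1.trans i2, ?_⟩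
  rw [← intervalIntegral.integral_add_adjacent_intervals i1 i2,
    intervalIntegral.integral_congr_uIoo e1, intervalIntegral.integral_congr_uIoo e2]
  simp [mul_comm]

/-- For τ_n ≤ T < τ_{n+1} and f ≥ 0, the average up to T lies between (∫ up to τ_n)/τ_{n+1} and (∫
up to τ_{n+1})/τ_n, both of which tend to v/u. -/
lemma tendsto_time_average {f : ℝ → ℝ} (hf : ∀ x, 0 ≤ f x) {τ : ℕ → ℝ} (hτ0 : τ 0 = 0)
    (hτ : StrictMono τ) (hint : ∀ n, IntervalIntegrable f volume (τ n) (τ (n + 1))) {u v : ℝ}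
    (hu : 0 < u) (hτu : Tendsto (fun n : ℕ => τ n / n) atTop (𝓝 u))
    (hv : Tendsto (fun n : ℕ => (∑ i ∈ Finset.range n, ∫ x in τ i..τ (i + 1), f x) / n) atTop
      (𝓝 v)) :
    (∀ T, 0 ≤ T → IntervalIntegrable f volume 0 T) ∧
      Tendsto (fun T => (1 / T) * ∫ x in 0..T, f x) atTop (𝓝 (v / u)) := by
  have hint0 : ∀ n, IntervalIntegrable f volume 0 (τ n) := fun n => by
    rw [← hτ0]
    exact IntervalIntegrable.trans_iterate fun i _ => hint i
  have hsum : ∀ n, ∑ i ∈ Finset.range n, ∫ x in τ i..τ (i + 1), f x = ∫ x in 0..τ n, f x := by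
    intro n
    rw [← hτ0]
    exact intervalIntegral.sum_integral_adjacent_intervals fun i _ => hint i
  simp only [hsum] at hv
  have hτtop : Tendsto τ atTop atTop := by
    have h1 : Tendsto (fun n : ℕ => τ n / n * n) atTop atTop :=
      hτu.pos_mul_atTop hu tendsto_natCast_atTop_atTop
    refine h1.congr' ?_
    filter_upwards [eventually_gt_atTop 0] with n hn
    have : (n : ℝ) ≠ 0 := by positivity
    field_simp
  have hintT : ∀ T, 0 ≤ T → IntervalIntegrable f volume 0 T := by
    intro T hT
    obtain ⟨n, hn⟩ := (hτtop.eventually_ge_atTop T).exists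
    exact (hint0 n).mono_set (by
      rw [Set.uIcc_of_le hT, Set.uIcc_of_le (hT.trans hn)]; exact Set.Icc_subset_Icc_right hn)
  refine ⟨hintT, ?_⟩
  have hmono : ∀ S T, 0 ≤ S → S ≤ T → ∫ x in 0..S, f x ≤ ∫ x in 0..T, f x := fun S T hS hST =>
    intervalIntegral.integral_mono_interval le_rfl hS hST (ae_of_all _ fun x => hf x)
      (hintT T (hS.trans hST))
  have hI0 : ∀ T, 0 ≤ T → 0 ≤ ∫ x in 0..T, f x := fun T hT =>
    intervalIntegral.integral_nonneg_of_forall hT hf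
  have hratio : Tendsto (fun n : ℕ => (n : ℝ) / ((n : ℝ) + 1)) atTop (𝓝 1) :=
    tendsto_natCast_div_add_atTop 1
  have hτu1 : Tendsto (fun n : ℕ => τ (n + 1) / ((n : ℝ) + 1)) atTop (𝓝 u) := by
    simpa using (tendsto_add_atTop_iff_nat 1).2 hτu
  have hv1 : Tendsto (fun n : ℕ => (∫ x in 0..τ (n + 1), f x) / ((n : ℝ) + 1)) atTop (𝓝 v) := by
    simpa using (tendsto_add_atTop_iff_nat 1).2 hv
  have hlo : Tendsto (fun n => (∫ x in 0..τ n, f x) / τ (n + 1)) atTop (𝓝 (v / u)) := by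
    have h1 := (hv.mul hratio).div hτu1 hu.ne'
    rw [mul_one] at h1
    refine h1.congr' ?_
    filter_upwards [eventually_gt_atTop 0] with n hn
    have h2 : (n : ℝ) ≠ 0 := by positivity
    have h3 : (n : ℝ) + 1 ≠ 0 := by positivity
    simp only [Pi.div_apply]
    field_simp
  have hhi : Tendsto (fun n => (∫ x in 0..τ (n + 1), f x) / τ n) atTop (𝓝 (v / u)) := by
    have h1 := hv1.div (hτu.mul hratio) (by simpa using hu.ne')
    rw [mul_one] at h1
    refine h1.congr' ?_
    filter_upwards [eventually_gt_atTop 0] with n hn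
    have h2 : (n : ℝ) ≠ 0 := by positivity
    have h3 : (n : ℝ) + 1 ≠ 0 := by positivity
    simp only [Pi.div_apply]
    field_simp
  have hτpos : ∀ n, 0 < τ (n + 1) := fun n => hτ0 ▸ hτ (Nat.succ_pos n)
  have key : ∀ m T, τ (m + 1) ≤ T → ∃ n, m ≤ n ∧
      (∫ x in 0..τ n, f x) / τ (n + 1) ≤ (1 / T) * ∫ x in 0..T, f x ∧
      (1 / T) * ∫ x in 0..T, f x ≤ (∫ x in 0..τ (n + 1), f x) / τ n := by
    intro m T hmT
    have hex : ∃ n, T < τ (n + 1) := by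
      obtain ⟨n, hn⟩ := (((tendsto_add_atTop_iff_nat 1).2 hτtop).eventually_gt_atTop T).exists
      exact ⟨n, hn⟩
    classical
    set n := Nat.find hex with hn
    have hn1 : T < τ (n + 1) := Nat.find_spec hex
    have hmn : m < n := by
      have := hτ.lt_iff_lt.1 (hmT.trans_lt hn1)
      omega
    have hn2 : τ n ≤ T := by
      have := Nat.find_min hex (m := n - 1) (by omega)
      rwa [Nat.sub_add_cancel (by omega), not_lt] at this
    have hT0 : 0 < T := (hτpos m).trans_le hmT
    have hτn : 0 < τ n := by
      have := hτpos (n - 1)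
      rwa [Nat.sub_add_cancel (by omega)] at this
    refine ⟨n, hmn.le, ?_, ?_⟩
    · rw [one_div_mul_eq_div]
      exact div_le_div₀ (hI0 T hT0.le) (hmono _ _ hτn.le hn2) hT0 hn1.le
    · rw [one_div_mul_eq_div]
      exact div_le_div₀ (hI0 _ (hτpos n).le) (hmono _ _ hT0.le hn1.le) hτn hn2
  refine tendsto_order.2 ⟨fun a ha => ?_, fun a ha => ?_⟩
  · obtain ⟨m, hm⟩ := eventually_atTop.1 (hlo.eventually (lt_mem_nhds ha))
    filter_upwards [eventually_ge_atTop (τ (m + 1))] with T hT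
    obtain ⟨n, hmn, h1, -⟩ := key m T hT
    exact (hm n hmn).trans_le h1
  · obtain ⟨m, hm⟩ := eventually_atTop.1 (hhi.eventually (gt_mem_nhds ha))
    filter_upwards [eventually_ge_atTop (τ (m + 1))] with T hT
    obtain ⟨n, hmn, -, h1⟩ := key m T hT
    exact h1.trans_lt (hm n hmn)

end TimeAverage

/-- With no success before L the supremum is sSup ∅ = 0 and the staleness is L, which is why step 0
starts with staleness 0. -/
lemma sSup_add_staleness (s : ℕ → Prop) (L : ℕ) :
    sSup {ℓ | ℓ < L ∧ s ℓ} + staleness s L = L := by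
  induction L with
  | zero => simp [staleness]
  | succ L ih =>
    by_cases hs : s L
    · have h1 : IsGreatest {ℓ | ℓ < L + 1 ∧ s ℓ} L :=
        ⟨⟨Nat.lt_succ_self L, hs⟩, fun ℓ hℓ => Nat.lt_succ_iff.1 hℓ.1⟩
      rw [h1.csSup_eq]
      simp [staleness, hs]
    · have h1 : {ℓ | ℓ < L + 1 ∧ s ℓ} = {ℓ | ℓ < L ∧ s ℓ} := by
        ext ℓ
        simp only [Set.mem_ofPred_eq]
        refine ⟨fun ⟨h2, h3⟩ => ⟨lt_of_le_of_ne (Nat.lt_succ_iff.1 h2) ?_, h3⟩,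
          fun ⟨h2, h3⟩ => ⟨h2.trans (Nat.lt_succ_self L), h3⟩⟩
        rintro rfl
        exact hs h3
      rw [h1]
      simp only [staleness, hs, if_false]
      omega

/-! ### The age along a single path -/

section Path

variable {Ω : Type*} {n : ℕ} {G : Digraph (Option (Fin n))}

/-- The counters of the network as one family; `none` stands for the source. -/
def family (N₀ : ℝ≥0 → Ω → ℕ) (N : GossipEdge G → ℝ≥0 → Ω → ℕ) :
    Option (GossipEdge G) → ℝ≥0 → Ω → ℕ
  | none => N₀
  | some e => N e

variable {mΩ : MeasurableSpace Ω} {P : Measure Ω} {N₀ : ℝ≥0 → Ω → ℕ}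
  {N : GossipEdge G → ℝ≥0 → Ω → ℕ} {r : Option (GossipEdge G) → ℝ≥0} {j : Fin n} {ω : Ω} {k : ℕ}

/-- A key of version ℓ crosses e only while ℓ is current, so what matters is whether the first
activation after τ_ℓ precedes τ_{ℓ+1}. An activation exactly at τ_ℓ would carry version ℓ but be
missed by `gap`; `hties` rules it out. -/
lemma key_iff (h : IsPoissonFamily P (family N₀ N) r)
    (hsrc : ∀ ℓ, N₀ (arrivalTime N₀ ℓ ω) ω = ℓ) (e : GossipEdge G)
    (hties : ∀ a b, arrivalTime (N e) (a + 1) ω ≠ arrivalTime N₀ (b + 1) ω)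
    (ℓ : ℕ) (t : ℝ≥0) :
    (∃ a, 1 ≤ a ∧ arrivalTime (N e) a ω ≤ t ∧ N₀ (arrivalTime (N e) a ω) ω = ℓ) ↔
      arrivalTime N₀ ℓ ω + gap (N e) (arrivalTime N₀ ℓ ω) ω ≤ t ∧
        gap (N e) (arrivalTime N₀ ℓ ω) ω < gap N₀ (arrivalTime N₀ ℓ ω) ω := by
  have hle0 : ∀ a t, arrivalTime N₀ a ω ≤ t ↔ a ≤ N₀ t ω := fun a t => h.arrivalTime_le_iff none a ω t
  have hle : ∀ a t, arrivalTime (N e) a ω ≤ t ↔ a ≤ N e t ω :=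
    fun a t => h.arrivalTime_le_iff (some e) a ω t
  have hg0 : arrivalTime N₀ ℓ ω + gap N₀ (arrivalTime N₀ ℓ ω) ω = arrivalTime N₀ (ℓ + 1) ω :=
    h.add_gap_eq_arrivalTime none (hsrc ℓ)
  have hg : arrivalTime N₀ ℓ ω + gap (N e) (arrivalTime N₀ ℓ ω) ω =
      arrivalTime (N e) (N e (arrivalTime N₀ ℓ ω) ω + 1) ω :=
    h.add_gap_eq_arrivalTime (some e) rfl
  rw [← add_lt_add_iff_left (arrivalTime N₀ ℓ ω) (b := gap (N e) (arrivalTime N₀ ℓ ω) ω), hg0, hg]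
  set τ := arrivalTime N₀ ℓ ω with hτ
  constructor
  · rintro ⟨a, ha, hat, haℓ⟩
    set s := arrivalTime (N e) a ω with hs
    have h1 : τ ≤ s := (hle0 ℓ s).2 haℓ.ge
    have h2 : s < arrivalTime N₀ (ℓ + 1) ω := by
      rw [← not_le, hle0]; omega
    have h3 : a ≤ N e s ω := (hle a s).1 le_rfl
    have h4 : τ ≠ s := by
      intro heq
      -- `hties` says nothing about the zeroth point. For ℓ = 0 a coincidence would be an activation
      -- at time 0, where the counter vanishes.
      rcases Nat.eq_zero_or_pos ℓ with rfl | hℓ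
      · have h5 : τ = 0 := h.arrivalTime_zero none ω
        rw [← heq, h5, show N e 0 ω = 0 from h.zero (some e) ω] at h3
        omega
      · refine hties (a - 1) (ℓ - 1) ?_
        rw [Nat.sub_add_cancel ha, Nat.sub_add_cancel hℓ]
        exact heq.symm
    have h5 : N e τ ω < a := by
      rw [← not_le, ← hle]
      exact (lt_of_le_of_ne h1 h4).not_ge
    have h6 : arrivalTime (N e) (N e τ ω + 1) ω ≤ s := (hle _ _).2 (by omega)
    exact ⟨h6.trans hat, h6.trans_lt h2⟩
  · rintro ⟨h1, h2⟩
    refine ⟨N e τ ω + 1, Nat.le_add_left 1 _, h1, le_antisymm ?_ ?_⟩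
    · rw [← not_le, hle0] at h2
      omega
    · rw [← hle0, ← hτ, ← hg]
      exact le_self_add

lemma keysReceived_eq_empty (h : IsPoissonFamily P (family N₀ N) r) {ℓ : ℕ} {t : ℝ≥0}
    (hℓ : N₀ t ω < ℓ) : keysReceived N₀ N j ℓ t ω = ∅ := by
  refine Set.eq_empty_of_forall_notMem fun i hi => ?_
  rcases hi with ⟨-, hi⟩ | ⟨hij, a, -, hat, haℓ⟩
  · exact absurd ((h.arrivalTime_le_iff none ℓ ω t).1 hi) hℓ.not_ge
  · have h1 : N₀ (arrivalTime (N ⟨(i, j), hij⟩) a ω) ω ≤ N₀ t ω := h.monotone none ω hat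
    omega

/-- The receiver's own key accounts for the difference between k + 1 and k; without self-loops it is
not also a neighbor's key. -/
lemma le_ncard_keysReceived_iff (h : IsPoissonFamily P (family N₀ N) r)
    (hloop : ∀ v, ¬ G.Adj v v) (hsrc : ∀ ℓ, N₀ (arrivalTime N₀ ℓ ω) ω = ℓ)
    (hties : ∀ (i : InNeighbor G j) a b,
      arrivalTime (N i.edge) (a + 1) ω ≠ arrivalTime N₀ (b + 1) ω)
    {ℓ : ℕ} {t : ℝ≥0} (hℓ : ℓ ≤ N₀ t ω) :
    k + 1 ≤ (keysReceived N₀ N j ℓ t ω).ncard ↔ k ≤ {i : InNeighbor G j |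
      arrivalTime N₀ ℓ ω + gap (N i.edge) (arrivalTime N₀ ℓ ω) ω ≤ t ∧
        gap (N i.edge) (arrivalTime N₀ ℓ ω) ω < gap N₀ (arrivalTime N₀ ℓ ω) ω}.ncard := by
  set A := {i : InNeighbor G j |
      arrivalTime N₀ ℓ ω + gap (N i.edge) (arrivalTime N₀ ℓ ω) ω ≤ t ∧
        gap (N i.edge) (arrivalTime N₀ ℓ ω) ω < gap N₀ (arrivalTime N₀ ℓ ω) ω} with hA
  have h1 : keysReceived N₀ N j ℓ t ω = insert j (Subtype.val '' A) := by
    ext i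
    simp only [keysReceived, Set.mem_ofPred_eq, Set.mem_insert_iff, Set.mem_image, Subtype.exists,
      exists_and_right, exists_eq_right]
    have h2 : arrivalTime N₀ ℓ ω ≤ t := (h.arrivalTime_le_iff none ℓ ω t).2 hℓ
    simp only [h2, and_true]
    refine or_congr Iff.rfl (exists_congr fun hij => ?_)
    exact key_iff h hsrc ⟨(i, j), hij⟩ (hties ⟨i, hij⟩) ℓ t
  have hj : j ∉ Subtype.val '' A := by
    rintro ⟨i, -, hi⟩
    have := i.2
    rw [hi] at this
    exact hloop _ this
  rw [h1, Set.ncard_insert_of_notMem hj (Set.toFinite _),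
    Set.ncard_image_of_injective _ Subtype.val_injective, Nat.add_le_add_iff_right]

/-- For the current version the condition of arriving before the next update is automatic; for an
older one the deadline t is automatic, so its decryption depends only on whether its cycle
succeeded. -/
lemma versionAge_eq (h : IsPoissonFamily P (family N₀ N) r)
    (hloop : ∀ v, ¬ G.Adj v v) (hk : 1 ≤ k) (hkι : k ≤ Nat.card (InNeighbor G j))
    (hsrc : ∀ ℓ, N₀ (arrivalTime N₀ ℓ ω) ω = ℓ)
    (hties : ∀ (i : InNeighbor G j) a b,
      arrivalTime (N i.edge) (a + 1) ω ≠ arrivalTime N₀ (b + 1) ω) (t : ℝ≥0) :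
    versionAge k N₀ N j t ω =
      if orderStat k (fun i : InNeighbor G j =>
          (gap (N i.edge) (arrivalTime N₀ (N₀ t ω) ω) ω : ℝ)) ≤ t - arrivalTime N₀ (N₀ t ω) ω
      then 0
      else (staleness (fun m => orderStat k (fun i : InNeighbor G j =>
        (gap (N i.edge) (arrivalTime N₀ m ω) ω : ℝ)) < gap N₀ (arrivalTime N₀ m ω) ω)
          (N₀ t ω) : ℝ) := by
  classical
  set L := N₀ t ω with hL
  have hle0 : ∀ a t, arrivalTime N₀ a ω ≤ t ↔ a ≤ N₀ t ω := fun a t => h.arrivalTime_le_iff none a ω t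
  have hg0 : ∀ ℓ, arrivalTime N₀ ℓ ω + gap N₀ (arrivalTime N₀ ℓ ω) ω = arrivalTime N₀ (ℓ + 1) ω :=
    fun ℓ => h.add_gap_eq_arrivalTime none (hsrc ℓ)
  have hcard : ∀ ℓ ≤ L, k + 1 ≤ (keysReceived N₀ N j ℓ t ω).ncard ↔ _ := fun ℓ hℓ =>
    le_ncard_keysReceived_iff h hloop hsrc hties hℓ
  have hcur : k + 1 ≤ (keysReceived N₀ N j L t ω).ncard ↔ orderStat k (fun i : InNeighbor G j =>
      (gap (N i.edge) (arrivalTime N₀ L ω) ω : ℝ)) ≤ t - arrivalTime N₀ L ω := by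
    have h1 : t < arrivalTime N₀ (L + 1) ω := by rw [← not_le, hle0]; omega
    rw [hcard L le_rfl, orderStat_le_iff hk hkι]
    have h2 : ∀ i : InNeighbor G j,
        (arrivalTime N₀ L ω + gap (N i.edge) (arrivalTime N₀ L ω) ω ≤ t ∧
          gap (N i.edge) (arrivalTime N₀ L ω) ω < gap N₀ (arrivalTime N₀ L ω) ω) ↔
        (gap (N i.edge) (arrivalTime N₀ L ω) ω : ℝ) ≤ t - arrivalTime N₀ L ω := fun i => by
      rw [le_sub_iff_add_le', ← NNReal.coe_add, NNReal.coe_le_coe]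
      refine and_iff_left_of_imp fun h3 => ?_
      rw [← add_lt_add_iff_left (arrivalTime N₀ L ω), hg0]
      exact h3.trans_lt h1
    simp only [h2]
  have hold : ∀ ℓ < L, k + 1 ≤ (keysReceived N₀ N j ℓ t ω).ncard ↔
      orderStat k (fun i : InNeighbor G j =>
        (gap (N i.edge) (arrivalTime N₀ ℓ ω) ω : ℝ)) < gap N₀ (arrivalTime N₀ ℓ ω) ω := by
    intro ℓ hℓ
    have h1 : arrivalTime N₀ (ℓ + 1) ω ≤ t := (hle0 _ _).2 hℓ
    rw [hcard ℓ hℓ.le, orderStat_lt_iff hk hkι]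
    have h2 : ∀ i : InNeighbor G j,
        (arrivalTime N₀ ℓ ω + gap (N i.edge) (arrivalTime N₀ ℓ ω) ω ≤ t ∧
          gap (N i.edge) (arrivalTime N₀ ℓ ω) ω < gap N₀ (arrivalTime N₀ ℓ ω) ω) ↔
        (gap (N i.edge) (arrivalTime N₀ ℓ ω) ω : ℝ) < gap N₀ (arrivalTime N₀ ℓ ω) ω := fun i => by
      rw [NNReal.coe_lt_coe]
      refine and_iff_right_of_imp fun h3 => ?_
      have h4 := add_lt_add_right h3 (arrivalTime N₀ ℓ ω)
      rw [hg0] at h4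
      exact h4.le.trans h1
    simp only [h2]
  have hnew : ∀ ℓ, k + 1 ≤ (keysReceived N₀ N j ℓ t ω).ncard → ℓ ≤ L := by
    intro ℓ hℓ
    by_contra h1
    rw [keysReceived_eq_empty h (not_le.1 h1), Set.ncard_empty] at hℓ
    omega
  rw [versionAge, latestDecrypted, ← hL]
  split_ifs with hcase
  · have h1 : IsGreatest {ℓ | k + 1 ≤ (keysReceived N₀ N j ℓ t ω).ncard} L :=
      ⟨hcur.2 hcase, hnew⟩
    rw [h1.csSup_eq, sub_self]
  · have h1 : {ℓ | k + 1 ≤ (keysReceived N₀ N j ℓ t ω).ncard} =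
        {ℓ | ℓ < L ∧ orderStat k (fun i : InNeighbor G j =>
          (gap (N i.edge) (arrivalTime N₀ ℓ ω) ω : ℝ)) < gap N₀ (arrivalTime N₀ ℓ ω) ω} := by
      ext ℓ
      simp only [Set.mem_ofPred_eq]
      constructor
      · intro hℓ
        have h2 : ℓ < L := lt_of_le_of_ne (hnew ℓ hℓ) (by rintro rfl; exact hcase (hcur.1 hℓ))
        exact ⟨h2, (hold ℓ h2).1 hℓ⟩
      · rintro ⟨h2, h3⟩
        exact (hold ℓ h2).2 h3
    rw [h1]
    set s : ℕ → Prop := fun m => orderStat k (fun i : InNeighbor G j =>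
        (gap (N i.edge) (arrivalTime N₀ m ω) ω : ℝ)) < gap N₀ (arrivalTime N₀ m ω) ω with hs
    have h2 : ((sSup {ℓ | ℓ < L ∧ s ℓ} : ℕ) : ℝ) + staleness s L = L := by
      exact_mod_cast sSup_add_staleness s L
    linarith

lemma versionAge_nonneg (h : IsPoissonFamily P (family N₀ N) r)
    (hloop : ∀ v, ¬ G.Adj v v) (hk : 1 ≤ k) (hkι : k ≤ Nat.card (InNeighbor G j))
    (hsrc : ∀ ℓ, N₀ (arrivalTime N₀ ℓ ω) ω = ℓ)
    (hties : ∀ (i : InNeighbor G j) a b,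
      arrivalTime (N i.edge) (a + 1) ω ≠ arrivalTime N₀ (b + 1) ω) (t : ℝ≥0) :
    0 ≤ versionAge k N₀ N j t ω := by
  rw [versionAge_eq h hloop hk hkι hsrc hties]
  split_ifs <;> positivity

end Path

/-! ### Removing exceptional paths -/

section Modification

variable {Ω : Type*} {mΩ : MeasurableSpace Ω} {P : Measure Ω}

lemma tendsto_poissonMeasure_Iio {r : ℝ≥0} (hr : 0 < r) (a : ℕ) :
    Tendsto (fun n : ℕ => poissonMeasure (r * n) (Set.Iio a)) atTop (𝓝 0) := by
  have h1 : ∀ x : ℝ≥0, poissonMeasure x (Set.Iio a) =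
      ENNReal.ofReal (∑ i ∈ Finset.range a, Real.exp (-x) * x ^ i / i.factorial) := by
    intro x
    have h2 : Set.Iio a = ((Finset.range a : Finset ℕ) : Set ℕ) := by ext; simp
    rw [h2, ← ofReal_measureReal, ← sum_measureReal_singleton]
    simp only [poissonMeasure_real_singleton]
  simp only [h1]
  rw [← ENNReal.ofReal_zero]
  refine ENNReal.tendsto_ofReal ?_
  have hx : Tendsto (fun n : ℕ => ((r * n : ℝ≥0) : ℝ)) atTop atTop := by
    simp only [NNReal.coe_mul, NNReal.coe_natCast]
    exact tendsto_natCast_atTop_atTop.const_mul_atTop (NNReal.coe_pos.2 hr)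
  have h3 : ∀ i ∈ Finset.range a, Tendsto (fun n : ℕ => Real.exp (-((r * n : ℝ≥0) : ℝ)) *
      ((r * n : ℝ≥0) : ℝ) ^ i / i.factorial) atTop (𝓝 0) := fun i _ => by
    have h4 := ((Real.tendsto_pow_mul_exp_neg_atTop_nhds_zero i).comp hx).div_const
      (i.factorial : ℝ)
    rw [zero_div] at h4
    exact h4.congr fun n => by simp only [Function.comp_apply]; ring
  simpa using tendsto_finsetSum _ h3

lemma IsPoissonCounter.ae_unbounded {N : ℝ≥0 → Ω → ℕ} {r : ℝ≥0} (hN : IsPoissonCounter P N r)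
    (hr : 0 < r) : ∀ᵐ ω ∂P, ∀ a, ∃ t, a ≤ N t ω := by
  refine ae_all_iff.2 fun a => ?_
  rw [ae_iff]
  refine le_antisymm (ge_of_tendsto' (tendsto_poissonMeasure_Iio hr a) fun n => ?_) zero_le
  have hm : Measurable fun ω => N n ω - N 0 ω := (hN.measurable _).sub (hN.measurable _)
  have h1 := (hN.law 0 n zero_le).map_eq
  rw [tsub_zero] at h1
  rw [← h1, Measure.map_apply hm measurableSet_Iio]
  refine measure_mono fun ω hω => ?_
  simp only [Set.mem_ofPred_eq, not_exists, not_le] at hω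
  exact (Nat.sub_le _ _).trans_lt (hω n)

/-- Independent Poisson counters agree almost surely with a family all of whose paths are well
behaved. -/
lemma exists_isPoissonFamily {C : Type*} [Finite C] [IsProbabilityMeasure P]
    {N : C → ℝ≥0 → Ω → ℕ} {r : C → ℝ≥0} (hN : ∀ c, IsPoissonCounter P (N c) (r c))
    (hr : ∀ c, 0 < r c) (hind : iIndepFun (fun c ω t => N c t ω) P) :
    ∃ g : Ω → Ω, (∀ᵐ ω ∂P, g ω = ω) ∧ IsPoissonFamily P (fun c t ω => N c t (g ω)) r := by
  classical
  have hgood : ∀ᵐ ω ∂P, ∀ c, N c 0 ω = 0 ∧ Monotone (fun t => N c t ω) ∧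
      (∀ t, ContinuousWithinAt (fun s => N c s ω) (Set.Ici t) t) ∧ ∀ a, ∃ t, a ≤ N c t ω := by
    refine ae_all_iff.2 fun c => ?_
    filter_upwards [(hN c).zero, (hN c).monotone, (hN c).rightContinuous,
      (hN c).ae_unbounded (hr c)] with ω h1 h2 h3 h4
    exact ⟨h1, h2, h3, h4⟩
  -- The bad set is enlarged to a measurable null set, so that the map `g` sending it to one good
  -- point ω₀ is measurable.
  obtain ⟨S, hsub, hSm, hS0⟩ := exists_measurable_superset_of_null (ae_iff.1 hgood)
  have hgoodS : ∀ ω, ω ∉ S → ∀ c, N c 0 ω = 0 ∧ Monotone (fun t => N c t ω) ∧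
      (∀ t, ContinuousWithinAt (fun s => N c s ω) (Set.Ici t) t) ∧ ∀ a, ∃ t, a ≤ N c t ω := by
    intro ω hω
    by_contra hcon
    exact hω (hsub hcon)
  have haeS : ∀ᵐ ω ∂P, ω ∉ S := measure_eq_zero_iff_ae_notMem.1 hS0
  obtain ⟨ω₀, hω₀⟩ := haeS.exists
  set g : Ω → Ω := fun ω => if ω ∈ S then ω₀ else ω with hg
  have hgm : Measurable g := Measurable.ite hSm measurable_const measurable_id
  have hgS : ∀ ω, g ω ∉ S := fun ω => by
    by_cases hω : ω ∈ S <;> simp [hg, hω, hω₀]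
  have hgae : ∀ᵐ ω ∂P, g ω = ω := by
    filter_upwards [haeS] with ω hω
    simp [hg, hω]
  have hNae : ∀ c t, N c t =ᵐ[P] fun ω => N c t (g ω) := fun c t => by
    filter_upwards [hgae] with ω hω
    rw [hω]
  refine ⟨g, hgae, ?_⟩
  constructor
  · exact fun c t => ((hN c).measurable t).comp hgm
  · exact fun c ω => (hgoodS _ (hgS ω) c).1
  · exact fun c ω => (hgoodS _ (hgS ω) c).2.1
  · intro c ω t
    have h1 : Tendsto (fun s => N c s (g ω)) (𝓝[≥] t) (𝓝 (N c t (g ω))) :=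
      (hgoodS _ (hgS ω) c).2.2.1 t
    exact h1.eventually ((isOpen_discrete {N c t (g ω)}).mem_nhds rfl)
  · exact fun c ω => (hgoodS _ (hgS ω) c).2.2.2
  · intro c m t ht
    refine ((hN c).indepIncrements m t ht).congr fun i => ?_
    filter_upwards [hgae] with ω hω
    rw [hω]
  · intro c s t hst
    have h1 := (hN c).law s t hst
    have h2 : (fun ω => N c t ω - N c s ω) =ᵐ[P] fun ω => N c t (g ω) - N c s (g ω) := by
      filter_upwards [hgae] with ω hω
      rw [hω]
    exact ⟨h1.aemeasurable.congr h2, by rw [← Measure.map_congr h2, h1.map_eq]⟩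
  · refine hind.congr fun c => ?_
    filter_upwards [hgae] with ω hω
    rw [hω]
  · exact hr

end Modification

/-! ### Assembly for the network -/

section Network

variable {Ω : Type*} {mΩ : MeasurableSpace Ω} {P : Measure Ω} {n k : ℕ}
  {G : Digraph (Option (Fin n))} {N₀ : ℝ≥0 → Ω → ℕ} {N : GossipEdge G → ℝ≥0 → Ω → ℕ}
  {r : Option (GossipEdge G) → ℝ≥0} {j : Fin n}

lemma IsTSSFeasible.le_card_inNeighbor (hG : IsTSSFeasible G k) (j : Fin n) :
    k ≤ Nat.card (InNeighbor G j) := by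
  have h1 : {v : Option (Fin n) | G.Adj v (some j)} ⊆
      insert none (some '' {i : Fin n | G.Adj (some i) (some j)}) := by
    rintro (_ | i) hv
    · exact Set.mem_insert _ _
    · exact Set.mem_insert_of_mem _ ⟨i, hv, rfl⟩
  have h2 := (hG.2 j).trans_le ((Set.ncard_le_ncard h1 (Set.toFinite _)).trans
    (Set.ncard_insert_le _ _))
  rw [Set.ncard_image_of_injective _ (Option.some_injective _)] at h2
  exact Nat.lt_succ_iff.1 h2

lemma intervalIntegral_versionAge_cycle (h : IsPoissonFamily P (family N₀ N) r)
    (hloop : ∀ v, ¬ G.Adj v v) (hk : 1 ≤ k) (hkι : k ≤ Nat.card (InNeighbor G j)) {ω : Ω}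
    (hsrc : ∀ ℓ, N₀ (arrivalTime N₀ ℓ ω) ω = ℓ)
    (hties : ∀ (i : InNeighbor G j) a b,
      arrivalTime (N i.edge) (a + 1) ω ≠ arrivalTime N₀ (b + 1) ω) (ℓ : ℕ) :
    IntervalIntegrable (fun s : ℝ => versionAge k N₀ N j s.toNNReal ω) volume
        (jumpTime N₀ ℓ ω) (jumpTime N₀ (ℓ + 1) ω) ∧
      ∫ s in (jumpTime N₀ ℓ ω : ℝ)..jumpTime N₀ (ℓ + 1) ω, versionAge k N₀ N j s.toNNReal ω =
        (staleness (fun m =>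
          cycleMin k (fun i : InNeighbor G j => some i.edge) none
            (gaps (family N₀ N) (jumpTime N₀ m) ω) <
          gaps (family N₀ N) (jumpTime N₀ m) ω none) ℓ : ℝ) *
        cycleMin k (fun i : InNeighbor G j => some i.edge) none
          (gaps (family N₀ N) (jumpTime N₀ ℓ) ω) := by
  have hjump : ∀ a, arrivalTime N₀ a ω = jumpTime N₀ a ω := h.arrivalTime_eq_jumpTime none hsrc
  set τ := jumpTime N₀ ℓ ω with hτ
  set W := gaps (family N₀ N) (jumpTime N₀ ℓ) ω with hW
  set M := cycleMin k (fun i : InNeighbor G j => some i.edge) none W with hM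
  set B := staleness (fun m => cycleMin k (fun i : InNeighbor G j => some i.edge) none
    (gaps (family N₀ N) (jumpTime N₀ m) ω) < gaps (family N₀ N) (jumpTime N₀ m) ω none) ℓ with hB
  have hend : (jumpTime N₀ (ℓ + 1) ω : ℝ) = τ + W none := by
    simp only [hW, gaps, jumpTime, NNReal.coe_add]
    rfl
  have hM0 : 0 ≤ M := cycleMin_nonneg hk hkι _ _ fun c => NNReal.coe_nonneg _
  have hMU : M ≤ W none := min_le_right _ _
  have hN₀ : ∀ x : ℝ, τ < x → x < τ + W none → N₀ x.toNNReal ω = ℓ := by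
    intro x h1 h2
    have hx : (x.toNNReal : ℝ) = x := Real.coe_toNNReal _ (τ.2.trans h1.le)
    have h3 := (h.arrivalTime_le_iff none ℓ ω x.toNNReal).1 (by
      change arrivalTime N₀ ℓ ω ≤ _
      rw [hjump, ← NNReal.coe_le_coe, hx]; exact h1.le)
    have h4 : ¬ arrivalTime N₀ (ℓ + 1) ω ≤ x.toNNReal := by
      rw [hjump, ← NNReal.coe_le_coe, hx, hend]; exact h2.not_ge
    have h5 := mt (h.arrivalTime_le_iff none (ℓ + 1) ω x.toNNReal).2 h4
    change ℓ ≤ N₀ x.toNNReal ω at h3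
    change ¬ ℓ + 1 ≤ N₀ x.toNNReal ω at h5
    omega
  have hage : ∀ x : ℝ, τ < x → x < τ + W none → versionAge k N₀ N j x.toNNReal ω =
      if orderStat k (fun i : InNeighbor G j => W (some i.edge)) ≤ x - τ then 0 else (B : ℝ) := by
    intro x h1 h2
    have hx : (x.toNNReal : ℝ) = x := Real.coe_toNNReal _ (τ.2.trans h1.le)
    rw [versionAge_eq h hloop hk hkι hsrc hties, hN₀ x h1 h2, hx]
    simp only [hjump, hB, cycleMin_lt_iff]
    rfl
  rw [hend]
  have := intervalIntegral_step (f := fun s : ℝ => versionAge k N₀ N j s.toNNReal ω) (B := (B : ℝ))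
    (a := τ) (b := τ + M) (d := τ + W none) (by linarith) (by linarith)
    (fun x h1 h2 => by
      have h3 : M ≤ orderStat k (fun i : InNeighbor G j => W (some i.edge)) := min_le_left _ _
      rw [hage x h1 (by linarith), if_neg (by linarith)])
    (fun x h1 h2 => by
      -- Within the cycle, x − τ exceeds the minimum M but not the cycle length, so the order
      -- statistic is the term below x − τ.
      have h3 : orderStat k (fun i : InNeighbor G j => W (some i.edge)) < x - τ := by
        have h4 : M < x - τ := by linarith
        exact (min_lt_iff.1 h4).resolve_right (by linarith)
      rw [hage x (by linarith) h2, if_pos h3.le])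
  rwa [add_sub_cancel_left] at this

lemma ae_tendsto_versionAge [IsProbabilityMeasure P] (h : IsPoissonFamily P (family N₀ N) r)
    [Fintype (GossipEdge G)] (hloop : ∀ v, ¬ G.Adj v v) (hk : 1 ≤ k)
    (hkι : k ≤ Nat.card (InNeighbor G j)) :
    ∀ᵐ ω ∂P,
      (∀ T : ℝ, IntervalIntegrable
        (fun s : ℝ => versionAge k N₀ N j s.toNNReal ω) volume 0 T) ∧
      Tendsto (fun T : ℝ => (1 / T) * ∫ s in (0 : ℝ)..T, versionAge k N₀ N j s.toNNReal ω) atTop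
        (𝓝 ((∫ w, cycleMin k (fun i : InNeighbor G j => some i.edge) none w ∂expPi r) /
          (expPi r).real {w | cycleMin k (fun i : InNeighbor G j => some i.edge) none w < w none} /
          ∫ w, w none ∂expPi r)) := by
  have hties : ∀ᵐ ω ∂P, ∀ (i : InNeighbor G j) a b,
      arrivalTime (N i.edge) (a + 1) ω ≠ arrivalTime N₀ (b + 1) ω :=
    ae_all_iff.2 fun i => h.ae_arrivalTime_ne (Option.some_ne_none i.edge)
  filter_upwards [h.ae_apply_arrivalTime none, hties, h.ae_tendsto_jumpTime_div none,
    h.ae_tendsto_average_staleness (c := none) (e := fun i : InNeighbor G j => some i.edge) hk hkι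
      fun i => Option.some_ne_none _] with ω hsrc hties hτ hv
  have hcycle := intervalIntegral_versionAge_cycle h hloop hk hkι hsrc hties
  obtain ⟨h1, h2⟩ := tendsto_time_average
    (f := fun s : ℝ => versionAge k N₀ N j s.toNNReal ω) (τ := fun ℓ => jumpTime N₀ ℓ ω)
    (fun s => versionAge_nonneg h hloop hk hkι hsrc hties _) (by simp [jumpTime])
    (strictMono_nat_of_lt_succ fun ℓ => NNReal.coe_lt_coe.2 (h.jumpTime_lt_succ none ℓ ω))
    (fun ℓ => (hcycle ℓ).1) (integral_eval_expPi_pos h.rate_pos none) hτ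
    (by simp only [(hcycle _).2]; exact hv)
  refine ⟨fun T => ?_, h2⟩
  rcases le_total 0 T with hT | hT
  · exact h1 T hT
  -- Negative times are sent to 0 by `toNNReal`, so the integrand is constant there.
  · refine (intervalIntegrable_const (c := versionAge k N₀ N j 0 ω)).congr fun x hx => ?_
    rw [Set.uIoc_of_ge hT] at hx
    simp only [Real.toNNReal_of_nonpos hx.2]

/-- The times X and U are taken at arbitrary indices, but their joint law is that of the waiting
times of a cycle, which turns the limit into the stated expectations. -/
lemma main_of_isPoissonFamily [IsProbabilityMeasure P] (h : IsPoissonFamily P (family N₀ N) r)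
    (hloop : ∀ v, ¬ G.Adj v v) (hG : IsTSSFeasible G k) (hk : 1 ≤ k) (b : ℕ)
    (a : GossipEdge G → ℕ) (X U : Ω → ℝ) (hX : X = edgeOrderStat k N a j)
    (hU : U = interarrivalTime N₀ b) :
    (Integrable U P ∧ Integrable (fun ω => min (X ω) (U ω)) P ∧
      0 < P.real {ω | X ω ≤ U ω} * ∫ ω, U ω ∂P) ∧
    ∀ᵐ ω ∂P,
      (∀ T : ℝ, IntervalIntegrable
        (fun s : ℝ => versionAge k N₀ N j s.toNNReal ω) volume 0 T) ∧
      Tendsto (fun T : ℝ => (1 / T) * ∫ s in (0 : ℝ)..T, versionAge k N₀ N j s.toNNReal ω) atTop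
        (𝓝 ((∫ ω', min (X ω') (U ω') ∂P) / (P.real {ω' | X ω' ≤ U ω'} * ∫ ω', U ω' ∂P))) := by
  classical
  have : Fintype (GossipEdge G) := Fintype.ofFinite _
  have := isProbabilityMeasure_expPi h.rate_pos
  have hkι := hG.le_card_inNeighbor j
  set e : InNeighbor G j → Option (GossipEdge G) := fun i => some i.edge with he
  have hec : ∀ i, e i ≠ none := fun i => Option.some_ne_none _
  set V : Ω → Option (GossipEdge G) → ℝ := fun ω c =>
    interarrivalTime (family N₀ N c) (c.elim b a) ω with hV
  have hVm : Measurable V := measurable_pi_lambda _ fun c => h.measurable_interarrivalTime c _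
  have hmap : P.map V = expPi r := h.map_interarrivalTime _
  have hXV : ∀ ω, X ω = orderStat k fun i => V ω (e i) := fun ω => by rw [hX]; rfl
  have hUV : ∀ ω, U ω = V ω none := fun ω => by rw [hU]; rfl
  have hMV : (fun ω => min (X ω) (U ω)) = fun ω => cycleMin k e none (V ω) := by
    funext ω; rw [hXV, hUV]; rfl
  have hMm := measurable_cycleMin hk hkι e none
  have hUeq : U = fun ω => V ω none := funext hUV
  have hintM : ∫ ω, min (X ω) (U ω) ∂P = ∫ w, cycleMin k e none w ∂expPi r := by
    rw [hMV, ← hmap, integral_map hVm.aemeasurable hMm.aestronglyMeasurable]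
  have hintU : ∫ ω, U ω ∂P = ∫ w, w none ∂expPi r := by
    rw [hUeq, ← hmap, integral_map hVm.aemeasurable (measurable_pi_apply _).aestronglyMeasurable]
  have hprob : P.real {ω | X ω ≤ U ω} = (expPi r).real {w | cycleMin k e none w < w none} := by
    rw [← measure_orderStat_le_eq h.rate_pos hk hkι hec, ← hmap, map_measureReal_apply hVm
      (measurableSet_le (measurable_orderStat hk hkι fun i => measurable_pi_apply _)
        (measurable_pi_apply _))]
    simp only [hXV, hUV]
    rfl
  refine ⟨⟨?_, ?_, ?_⟩, ?_⟩
  · rw [hUeq]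
    have h1 := (memLp_eval_expPi h.rate_pos (none : Option (GossipEdge G))).integrable one_le_two
    rw [← hmap] at h1
    exact h1.comp_measurable hVm
  · rw [hMV]
    have h1 := (memLp_cycleMin h.rate_pos hk hkι e none).integrable one_le_two
    rw [← hmap] at h1
    exact h1.comp_measurable hVm
  · rw [hprob, hintU]
    exact mul_pos (measure_cycleMin_lt_pos h.rate_pos hk hkι hec)
      (integral_eval_expPi_pos h.rate_pos none)
  · rw [hintM, hintU, hprob, ← div_div]
    exact ae_tendsto_versionAge h hloop hk hkι

end Network

end CodedGossip

theorem mainTheorem6 {Ω : Type*} [MeasurableSpace Ω] (P : Measure Ω) [IsProbabilityMeasure P]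
    (n k : ℕ) (hk : 1 ≤ k)
    (G : Digraph (Option (Fin n))) (hloop : ∀ v, ¬ G.Adj v v)
    (hG : CodedGossip.IsTSSFeasible G k)
    (rateS : ℝ≥0) (hrateS : 0 < rateS)
    (rate : CodedGossip.GossipEdge G → ℝ≥0) (hrate : ∀ e, 0 < rate e)
    (N₀ : ℝ≥0 → Ω → ℕ) (hN₀ : CodedGossip.IsPoissonCounter P N₀ rateS)
    (N : CodedGossip.GossipEdge G → ℝ≥0 → Ω → ℕ)
    (hN : ∀ e, CodedGossip.IsPoissonCounter P (N e) (rate e))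
    (hindep : iIndepFun (CodedGossip.counters N₀ N) P)
    (j : Fin n) (b : ℕ) (a : CodedGossip.GossipEdge G → ℕ)
    (X U : Ω → ℝ) (hX : X = CodedGossip.edgeOrderStat k N a j)
    (hU : U = CodedGossip.interarrivalTime N₀ b) :
    (Integrable U P ∧ Integrable (fun ω => min (X ω) (U ω)) P ∧
      0 < P.real {ω | X ω ≤ U ω} * ∫ ω, U ω ∂P) ∧
    ∀ᵐ ω ∂P,
      (∀ T : ℝ, IntervalIntegrable
        (fun s : ℝ => CodedGossip.versionAge k N₀ N j s.toNNReal ω) volume 0 T) ∧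
      Tendsto
        (fun T : ℝ => (1 / T) *
          ∫ s in (0 : ℝ)..T, CodedGossip.versionAge k N₀ N j s.toNNReal ω)
        atTop
        (𝓝 ((∫ ω', min (X ω') (U ω') ∂P) /
          (P.real {ω' | X ω' ≤ U ω'} * ∫ ω', U ω' ∂P))) := by
  have hfam : (fun c ω t => CodedGossip.family N₀ N c t ω) = CodedGossip.counters N₀ N := by
    funext c; cases c <;> rfl
  -- Precomposing with g changes X, U and the age only on a null set, so the result for well-behaved
  -- paths carries back.
  obtain ⟨g, hg, h⟩ := CodedGossip.exists_isPoissonFamily (P := P)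
    (N := CodedGossip.family N₀ N) (r := fun c => c.elim rateS rate)
    (fun c => match c with
      | none => hN₀
      | some e => hN e)
    (fun c => match c with
      | none => hrateS
      | some e => hrate e) (by rw [hfam]; exact hindep)
  have hfam' : (fun c t ω => CodedGossip.family N₀ N c t (g ω)) =
      CodedGossip.family (fun t ω => N₀ t (g ω)) (fun e t ω => N e t (g ω)) := by
    funext c; cases c <;> rfl
  rw [hfam'] at h
  obtain ⟨⟨h1, h2, h3⟩, h4⟩ := CodedGossip.main_of_isPoissonFamily (j := j) h hloop hG hk b a
    (fun ω => X (g ω)) (fun ω => U (g ω)) (by rw [hX]; rfl) (by rw [hU]; rfl)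
  have hUg : (fun ω => U (g ω)) =ᵐ[P] U := hg.mono fun ω hω => by simp only [hω]
  have hMg : (fun ω => min (X (g ω)) (U (g ω))) =ᵐ[P] fun ω => min (X ω) (U ω) :=
    hg.mono fun ω hω => by simp only [hω]
  have hpg : P.real {ω | X (g ω) ≤ U (g ω)} = P.real {ω | X ω ≤ U ω} :=
    measureReal_congr (hg.mono fun ω hω => by
      change (X (g ω) ≤ U (g ω)) = (X ω ≤ U ω)
      rw [hω])
  rw [integral_congr_ae hUg, hpg] at h3 h4
  rw [integral_congr_ae hMg] at h4
  refine ⟨⟨h1.congr hUg, h2.congr hMg, h3⟩, ?_⟩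
  filter_upwards [h4, hg] with ω h5 h6
  have h7 : ∀ t, CodedGossip.versionAge k (fun t ω => N₀ t (g ω)) (fun e t ω => N e t (g ω)) j t ω =
      CodedGossip.versionAge k N₀ N j t ω := fun t => by
    change CodedGossip.versionAge k N₀ N j t (g ω) = _
    rw [h6]
  simpa only [h7] using h5
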